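/- Let $0<l<\infty$, let $q\in L^2(0,l)$ be real-valued, and for $\lambda\in\mathbb C$, $p=0,1,2$, let $s_p(\lambda,x)$ be the solution on $[0,l]$ of $iy'''+qy=\lambda^3y$ with $y^{(j)}(0)=\delta_{jp}$ ($j=0,1,2$). For $\theta\in\mathbb T$ and $h\in\mathbb R$ let $$\Delta_\theta(q,\lambda)=s_2(\lambda,l)s_1'(\lambda,l)-s_1(\lambda,l)s_2'(\lambda,l)-\theta s_2(\lambda,l),$$ $$\Delta_{\theta,h}(q,\lambda)=\det\begin{bmatrix}1&0&-ih\\ s_0'(\lambda,l)&s_1'(\lambda,l)-\theta&s_2'(\lambda,l)\\ s_0(\lambda,l)&s_1(\lambda,l)&s_2(\lambda,l)\end{bmatrix}$$ (the characteristic functions of $iD^3+q$ with the boundary conditions $y'(l)=\theta y'(0)$, $y(l)=0$ and, respectively, $y(0)=0$ or $y(0)=ihy''(0)$). Let $\{\lambda_n(q,\theta)\}$ and $\{\lambda_n(q,\theta,h)\}$ be the sets of their real zeros, put $a=s_2(0,l)$, $b=s_0(0,l)$, $\theta_0=\overline a/a$, $\theta_1=\overline b/b$, and define the spectral sets $$\mathfrak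 A_\theta=(a;\theta;\{\lambda_n(q,\theta)\}),\qquad \mathfrak A_{\theta,h}=(a;b;\theta;h;\{\lambda_n(q,\theta,h)\}).$$ Let $\theta,\widehat\theta\in\mathbb T$, $\theta\ne\widehat\theta$, $h\in\mathbb R$, $h\neq0$, and assume that for $\tau=\theta$ and for $\tau=\widehat\theta$ $$a\ne0,\qquad \tau+\theta_0\neq0,\qquad a(\tau+\theta_0)+ihb(\tau-\theta_1)\ne0 .$$ Then the four spectral sets $\mathfrak A_\theta,\mathfrak A_{\widehat\theta},\mathfrak A_{\theta,h},\mathfrak A_{\widehat\theta,h}$ uniquely determine the functions $s_2(\lambda,l)$ and $s_0(\lambda,l)$ of $\lambda\in\mathbb C$: if a second real potential in $L^2(0,l)$ has the same four spectral sets, then its functions $s_2(\lambda,l)$ and $s_0(\lambda,l)$ are the same. Explicitly, for every $\lambda\in\mathbb C$ and $\tau\in\{\theta,\widehat\theta\}$ the following products converge unconditionally and $$\Delta_\tau(q,\lambda)=-a(\tau+\theta_0)\prod_n\Bigl(1-\frac{\lambda^3}{\lambda_n^3(q,\tau)}\Bigr),\qquad \Delta_{\tau,h}(q,\lambda)=-\{a(\tau+\theta_0)+ihb(\tau-\theta_1)\}\prod_n\Bigl(1-\frac{\lambda^3}{\lambda_n^3(q,\tau,h)}\Bigr),$$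 and, with $\Pi(\tau)=a\prod_n\bigl(1-\lambda^3/\lambda_n^3(q,\tau)\bigr)$, $$s_2(\lambda,l)=\frac1{\theta-\widehat\theta}\bigl\{\Pi(\theta)(\theta+\theta_0)-\Pi(\widehat\theta)(\widehat\theta+\theta_0)\bigr\},$$ $$s_0(\lambda,l)=\frac1{ih(\theta-\widehat\theta)}\bigl\{\Delta_\theta(q,\lambda)-\Delta_{\widehat\theta}(q,\lambda)-\Delta_{\theta,h}(q,\lambda)+\Delta_{\widehat\theta,h}(q,\lambda)\bigr\},$$ where the functions $\Delta$ in the last formula are those given by the products, i.e. constructed from the spectral sets. -/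

import Mathlib

open Complex MeasureTheory Set

noncomputable section

namespace ThirdOrder

/-- `Y 0` is the solution `y` on `[0, l]` of the Cauchy problem
`i y''' + q y = lam ^ 3 y`, `y(0) = c 0`, `y'(0) = c 1`, `y''(0) = c 2`,
and `Y 1 = y'`, `Y 2 = y''`.  The equation is integrated once: `y''` is absolutely
continuous and `i y''' = (lam ^ 3 - q) y` almost everywhere. -/
structure IsCauchySolution (q : ℝ → ℝ) (l : ℝ) (lam : ℂ) (c : Fin 3 → ℂ)
    (Y : Fin 3 → ℝ → ℂ) : Prop where
  deriv_zero : ∀ x ∈ Icc 0 l, HasDerivWithinAt (Y 0) (Y 1 x) (Icc 0 l) x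
  deriv_one : ∀ x ∈ Icc 0 l, HasDerivWithinAt (Y 1) (Y 2 x) (Icc 0 l) x
  equation : ∀ x ∈ Icc 0 l,
    I * (Y 2 x - c 2) = ∫ t in (0 : ℝ)..x, (lam ^ 3 - (q t : ℂ)) * Y 0 t
  init_zero : Y 0 0 = c 0
  init_one : Y 1 0 = c 1

/-- The solution (with its first two derivatives) of the Cauchy problem with initial data
`y⁽ʲ⁾(0) = δ_{jp}`; it exists and is unique on `[0, l]` for `q ∈ L²(0, l)`. -/
def fundSol (q : ℝ → ℝ) (l : ℝ) (p : Fin 3) (lam : ℂ) : Fin 3 → ℝ → ℂ :=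
  Classical.epsilon (IsCauchySolution q l lam (Pi.single p 1))

/-- `s_p(lam, l)`. -/
def s (q : ℝ → ℝ) (l : ℝ) (p : Fin 3) (lam : ℂ) : ℂ := fundSol q l p lam 0 l

/-- `s_p'(lam, l)`, the derivative in `x` at `x = l`. -/
def s' (q : ℝ → ℝ) (l : ℝ) (p : Fin 3) (lam : ℂ) : ℂ := fundSol q l p lam 1 l

/-- Characteristic function of `i D³ + q` with
`y(0) = 0`, `y'(l) = θ y'(0)`, `y(l) = 0`. -/
def charFun (q : ℝ → ℝ) (l : ℝ) (θ : ℂ) (lam : ℂ) : ℂ :=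
  s q l 2 lam * s' q l 1 lam - s q l 1 lam * s' q l 2 lam - θ * s q l 2 lam

/-- Characteristic function of `i D³ + q` with
`y(0) = i h y''(0)`, `y'(l) = θ y'(0)`, `y(l) = 0`. -/
def charFunH (q : ℝ → ℝ) (l : ℝ) (θ : ℂ) (h : ℝ) (lam : ℂ) : ℂ :=
  Matrix.det !![1, 0, -I * h;
    s' q l 0 lam, s' q l 1 lam - θ, s' q l 2 lam;
    s q l 0 lam, s q l 1 lam, s q l 2 lam]

/-- Data `(a; θ; {λ_n})`. -/
@[ext]
structure SpectralSet where
  a : ℂ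
  θ : ℂ
  zeros : Set ℝ

/-- Data `(a; b; θ; h; {λ_n})`. -/
@[ext]
structure SpectralSetH where
  a : ℂ
  b : ℂ
  θ : ℂ
  h : ℝ
  zeros : Set ℝ

/-- The spectral set `𝔄_θ` of the potential `q`: `a = s₂(0, l)` and the `λ_n` are the real
zeros of the characteristic function. -/
def spectralSet (q : ℝ → ℝ) (l : ℝ) (θ : ℂ) : SpectralSet where
  a := s q l 2 0
  θ := θ
  zeros := {μ : ℝ | charFun q l θ μ = 0}

/-- The spectral set `𝔄_{θ,h}` of the potential `q`: `a = s₂(0, l)`, `b = s₀(0, l)` and the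
`λ_n` are the real zeros of the characteristic function. -/
def spectralSetH (q : ℝ → ℝ) (l : ℝ) (θ : ℂ) (h : ℝ) : SpectralSetH where
  a := s q l 2 0
  b := s q l 0 0
  θ := θ
  h := h
  zeros := {μ : ℝ | charFunH q l θ h μ = 0}

/-- `z̄ / z`, so that `θ₀ = phase a` and `θ₁ = phase b`. -/
def phase (z : ℂ) : ℂ := (starRingEnd ℂ) z / z

/-- `a ≠ 0`, `θ + θ₀ ≠ 0`, `a (θ + θ₀) + i h b (θ - θ₁) ≠ 0`. -/
def SpectralSetH.Admissible (A : SpectralSetH) : Prop :=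
  A.a ≠ 0 ∧ A.θ + phase A.a ≠ 0 ∧
    A.a * (A.θ + phase A.a) + I * A.h * A.b * (A.θ - phase A.b) ≠ 0

/-- The factor `1 - lam³ / μ³`. -/
def factor (lam : ℂ) (μ : ℝ) : ℂ := 1 - lam ^ 3 / (μ : ℂ) ^ 3

/-- `Π(θ) = a ∏_n (1 - lam³ / λ_n³)`. -/
def SpectralSet.prodFun (A : SpectralSet) (lam : ℂ) : ℂ :=
  A.a * ∏' μ : A.zeros, factor lam μ

/-- The function `Δ_θ` constructed from the data `𝔄_θ`. -/
def SpectralSet.delta (A : SpectralSet) (lam : ℂ) : ℂ :=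
  -(A.a * (A.θ + phase A.a)) * ∏' μ : A.zeros, factor lam μ

/-- The function `Δ_{θ,h}` constructed from the data `𝔄_{θ,h}`. -/
def SpectralSetH.delta (A : SpectralSetH) (lam : ℂ) : ℂ :=
  -(A.a * (A.θ + phase A.a) + I * A.h * A.b * (A.θ - phase A.b)) *
    ∏' μ : A.zeros, factor lam μ

/-- The right-hand side of the formula for `s₂(lam, l)`, built from two spectral sets. -/
def recoverS2 (A B : SpectralSet) (lam : ℂ) : ℂ :=
  1 / (A.θ - B.θ) *
    (A.prodFun lam * (A.θ + phase A.a) - B.prodFun lam * (B.θ + phase B.a))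

/-- The right-hand side of the formula for `s₀(lam, l)`, built from four spectral sets. -/
def recoverS0 (A B : SpectralSet) (AH BH : SpectralSetH) (lam : ℂ) : ℂ :=
  1 / (I * AH.h * (A.θ - B.θ)) *
    (A.delta lam - B.delta lam - AH.delta lam + BH.delta lam)

end ThirdOrder

end

/-! Everything is a function of `z = λ³`. Let `u = s₂ + i h s₀` be the solution with data `(i h, 0,
1)` and let `U(z)` be its value at `l`. Expanding the determinant gives `Δ_{θ,h} = s₁' u - s₁ u' - θ
u` at `l`. The conjugated two-by-two minors of two solutions solve the equation at the conjugate
parameter (`IsCauchySolution.wedge`). For `s₁` and `u` the resulting data are `-(i h, 0, 1)`, hence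
`Δ_{θ,h} = -(U^#(z) + θ U(z))` with `U^#(z) = conj (U (conj z))`. The case `h = 0` is `Δ_θ`.

`U` is of Hermite–Biehler type (`exists_isHermiteBiehler`). The Lagrange identity, applied to the
combination of `s₁` and `u` that vanishes at `l`, expresses `U(z) conj U(w) - U^#(z) conj (U^#(w))`
as `-i (z - conj w)` times a Gram kernel `K(z, w)`. Convexity of `|u|²` along the interval shows
that `U` has no zeros in the closed upper half-plane. For `|θ| = 1` all zeros of `U^# + θ U` are
therefore real and simple. A real `z` has exactly one real cube root, so the set of real `λ_n`,
without multiplicities, contains the full divisor in `z`.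

An exponentially weighted Volterra equation gives entire dependence on `z` and growth `exp
(O(√|z|))` (`exists_entire_solution`). For such a function with simple zeros the Hadamard product
has genus zero and no exponential factor (`hasProd_zeros`), so the zeros and the value at `0`
determine the function. That value is `-(conj U(0) + θ U(0))` with `U(0) = a + i h b`, which is the
stated constant.

Finally, the characteristic functions are affine in `θ`: the differences over two values of `θ` are
`-(θ - θ̂) s₂` and `-(θ - θ̂)(s₂ + i h s₀)`, and these yield both reconstruction formulas.
Uniqueness follows because the formulas use only the spectral sets. -/

noncomputable section

namespace ThirdOrder

open Filter Topology Metric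

/-! ### Entire functions of order less than one with simple zeros -/

/-- A zero-free holomorphic function on a disc, normalized at the centre, has a logarithm. -/
lemma exists_log_of_ne_zero {g : ℂ → ℂ} {R : ℝ} (hR : 0 < R)
    (hg : DifferentiableOn ℂ g (ball 0 R)) (hne : ∀ z ∈ ball (0 : ℂ) R, g z ≠ 0)
    (h0 : g 0 = 1) :
    ∃ L : ℂ → ℂ, DifferentiableOn ℂ L (ball 0 R) ∧ L 0 = 0 ∧
      ∀ z ∈ ball (0 : ℂ) R, exp (L z) = g z := by
  have hd : DifferentiableOn ℂ (fun z => deriv g z / g z) (ball 0 R) :=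
    (hg.deriv isOpen_ball).div hg hne
  obtain ⟨L, hL⟩ := hd.isExactOn_ball
  have h0R : (0 : ℂ) ∈ ball (0 : ℂ) R := mem_ball_self hR
  refine ⟨fun z => L z - L 0, fun z hz =>
    ((hL z hz).differentiableAt.sub_const _).differentiableWithinAt, by simp, ?_⟩
  -- `L` is a primitive of `g'/g`, so `g exp(-L)` is constant, equal to its value `1` at the centre.
  have hder : ∀ z ∈ ball (0 : ℂ) R,
      HasDerivAt (fun z => g z * exp (-(L z - L 0))) 0 z := by
    intro z hz
    have h1 := (hg.differentiableAt (isOpen_ball.mem_nhds hz)).hasDerivAt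
    have h2 := ((hL z hz).sub_const (L 0)).neg.cexp
    refine (h1.mul h2).congr_deriv ?_
    have h3 := hne z hz
    simp only [Pi.neg_apply]
    field_simp
    ring
  intro z hz
  have hconst := (convex_ball (0 : ℂ) R).is_const_of_fderivWithin_eq_zero (𝕜 := ℂ)
    (f := fun z => g z * exp (-(L z - L 0)))
    (fun w hw => (hder w hw).differentiableAt.differentiableWithinAt)
    (fun w hw => by
      rw [fderivWithin_of_isOpen isOpen_ball hw]
      ext
      rw [fderiv_apply_one_eq_deriv, (hder w hw).deriv]
      rfl)
    hz h0R
  simp only [h0, sub_self, neg_zero, Complex.exp_zero, mul_one, Complex.exp_neg] at hconst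
  field_simp at hconst
  exact hconst.symm

/-- Division of an entire function by a finite product over some of its zeros. -/
lemma exists_eq_prod_mul {f : ℂ → ℂ} (hf : Differentiable ℂ f) (h0 : f 0 ≠ 0)
    (S : Finset ℂ) (hS : ∀ a ∈ S, f a = 0) :
    ∃ g : ℂ → ℂ, Differentiable ℂ g ∧ ∀ z, f z = (∏ a ∈ S, (1 - z / a)) * g z := by
  classical
  induction S using Finset.induction_on with
  | empty => exact ⟨f, hf, by simp⟩
  | insert a S ha ih =>
    obtain ⟨g, hg, hfg⟩ := ih fun b hb => hS b (Finset.mem_insert_of_mem hb)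
    have hne : ∀ b ∈ insert a S, b ≠ 0 := by
      rintro b hb rfl
      exact h0 (hS _ hb)
    have ha0 : a ≠ 0 := hne a (Finset.mem_insert_self _ _)
    have hga : g a = 0 := by
      have h1 := hfg a
      rw [hS a (Finset.mem_insert_self _ _)] at h1
      refine (mul_eq_zero.1 h1.symm).resolve_left (Finset.prod_ne_zero_iff.2 fun b hb => ?_)
      have hb0 : b ≠ 0 := hne b (Finset.mem_insert_of_mem hb)
      rw [sub_ne_zero]
      intro h2
      rw [eq_comm, div_eq_one_iff_eq hb0] at h2
      exact ha (h2 ▸ hb)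
    -- The factor `-a` turns `1 - z / a` into `z - a`.
    refine ⟨fun z => -a * dslope g a z, ?_, fun z => ?_⟩
    · have : Differentiable ℂ (dslope g a) := by
        rw [← differentiableOn_univ]
        exact (differentiableOn_dslope univ_mem).2 hg.differentiableOn
      fun_prop
    · rw [Finset.prod_insert ha, hfg z]
      have h1 := sub_smul_dslope g a z
      rw [hga, sub_zero, smul_eq_mul] at h1
      rw [← h1]
      field_simp
      ring

/-! ### Zero counting and the product of genus zero. -/

section Growth

variable {f : ℂ → ℂ} {B D : ℝ}

/-- The quotient of `f` by the product over zeros in a disc of radius `R` is bounded by the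
maximum of `f` on the circle of radius `4 R`; the factors contribute at least `3` each. -/
lemma pow_card_mul_norm_le
    (hgr : ∀ z, ‖f z‖ ≤ Real.exp (D + B * √‖z‖)) {R : ℝ} (hR : 0 < R) {S : Finset ℂ}
    (hS : ∀ a ∈ S, a ≠ 0 ∧ ‖a‖ ≤ R) {g : ℂ → ℂ} (hg : Differentiable ℂ g)
    (hfg : ∀ z, f z = (∏ a ∈ S, (1 - z / a)) * g z) {z : ℂ} (hz : ‖z‖ ≤ R) :
    3 ^ S.card * ‖g z‖ ≤ Real.exp (D + 2 * B * √R) := by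
  have key : ∀ w ∈ frontier (ball (0 : ℂ) (4 * R)),
      ‖g w‖ ≤ Real.exp (D + 2 * B * √R) / 3 ^ S.card := by
    intro w hw
    rw [frontier_ball _ (by positivity), mem_sphere_zero_iff_norm] at hw
    rw [le_div_iff₀ (by positivity), mul_comm]
    have h1 : (3 : ℝ) ^ S.card ≤ ‖∏ a ∈ S, (1 - w / a)‖ := by
      rw [norm_prod, ← Finset.prod_const]
      refine Finset.prod_le_prod (fun _ _ => by norm_num) fun a ha => ?_
      obtain ⟨ha0, haR⟩ := hS a ha
      have hapos : 0 < ‖a‖ := norm_pos_iff.2 ha0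
      have h2 : 4 ≤ ‖w / a‖ := by
        rw [norm_div, hw, le_div_iff₀ hapos]
        linarith
      have h3 := norm_sub_norm_le (w / a) 1
      rw [norm_sub_rev, norm_one] at h3
      linarith
    calc (3 : ℝ) ^ S.card * ‖g w‖ ≤ ‖∏ a ∈ S, (1 - w / a)‖ * ‖g w‖ := by gcongr
      _ = ‖f w‖ := by rw [hfg w, norm_mul]
      _ ≤ Real.exp (D + B * √‖w‖) := hgr w
      _ = Real.exp (D + 2 * B * √R) := by
        rw [hw, Real.sqrt_mul (by norm_num), show (4 : ℝ) = 2 ^ 2 by norm_num,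
          Real.sqrt_sq (by norm_num)]
        ring_nf
  have h4 := norm_le_of_forall_mem_frontier_norm_le isBounded_ball hg.diffContOnCl key
    (z := z) (by
      rw [closure_ball _ (by positivity), mem_closedBall_zero_iff]
      linarith)
  rwa [le_div_iff₀ (by positivity), mul_comm] at h4

/-- Linear bound in `√R` for the number of zeros in a disc. -/
lemma card_zeros_le (hf : Differentiable ℂ f) (h0 : f 0 = 1)
    (hgr : ∀ z, ‖f z‖ ≤ Real.exp (D + B * √‖z‖)) {R : ℝ} (hR : 0 < R) {S : Finset ℂ}
    (hS : ∀ a ∈ S, f a = 0 ∧ ‖a‖ ≤ R) : (S.card : ℝ) ≤ D + 2 * B * √R := by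
  obtain ⟨g, hg, hfg⟩ := exists_eq_prod_mul hf (by simp [h0]) S fun a ha => (hS a ha).1
  have hg0 : g 0 = 1 := by simpa [h0] using (hfg 0).symm
  have hne : ∀ a ∈ S, a ≠ 0 := by
    rintro a ha rfl
    simpa [h0] using (hS 0 ha).1
  have h1 := pow_card_mul_norm_le hgr hR (fun a ha => ⟨hne a ha, (hS a ha).2⟩) hg hfg
    (z := 0) (by simpa using hR.le)
  rw [hg0, norm_one, mul_one] at h1
  -- Since `e < 3` and `g 0 = 1`, the bound `3 ^ n ≤ exp (D + 2 B √R)` gives the count without a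
  -- logarithmic constant.
  have h2 : Real.exp (S.card : ℝ) ≤ 3 ^ S.card := by
    rw [← Real.exp_one_pow]
    exact pow_le_pow_left₀ (Real.exp_pos _).le (by linarith [Real.exp_one_lt_d9]) _
  exact Real.exp_le_exp.1 (h2.trans h1)

lemma finite_zeros (hf : Differentiable ℂ f) (h0 : f 0 = 1)
    (hgr : ∀ z, ‖f z‖ ≤ Real.exp (D + B * √‖z‖)) {R : ℝ} (hR : 0 < R) :
    {a : ℂ | f a = 0 ∧ ‖a‖ ≤ R}.Finite := by
  by_contra hinf
  obtain ⟨n, hn⟩ := exists_nat_gt (D + 2 * B * √R)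
  obtain ⟨S, hS, hcard⟩ := Set.Infinite.exists_subset_card_eq hinf n
  have := card_zeros_le hf h0 hgr hR (S := S) fun a ha => hS ha
  rw [hcard] at this
  linarith

/-- Dyadic counting: the disc `|a| ≤ 2 ^ k` holds at most `D + 2 B 2^(k/2)` zeros, each charged at
most a constant times `2⁻ᵏ`, and `2^(k/2) 2⁻ᵏ` is summable. -/
lemma summable_inv_zeros (hf : Differentiable ℂ f) (h0 : f 0 = 1) (hB : 0 ≤ B) (hD : 0 ≤ D)
    (hgr : ∀ z, ‖f z‖ ≤ Real.exp (D + B * √‖z‖)) :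
    Summable fun a : {a : ℂ // f a = 0} => ‖(a : ℂ)‖⁻¹ := by
  classical
  obtain ⟨r, hr, hball⟩ : ∃ r > 0, ∀ a, f a = 0 → r ≤ ‖a‖ := by
    have h1 : ∀ᶠ z in 𝓝 (0 : ℂ), f z ≠ 0 :=
      hf.continuous.continuousAt.eventually_ne (by simp [h0])
    obtain ⟨r, hr, h2⟩ := Metric.eventually_nhds_iff.1 h1
    refine ⟨r, hr, fun a ha => ?_⟩
    by_contra! h3
    exact h2 (by simpa using h3) ha
  have hgeo1 : Summable fun k : ℕ => ((2 : ℝ)⁻¹) ^ k :=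
    summable_geometric_of_lt_one (by norm_num) (by norm_num)
  have hgeo2 : Summable fun k : ℕ => ((√2)⁻¹) ^ k :=
    summable_geometric_of_lt_one (by positivity)
      (inv_lt_one_of_one_lt₀ (by rw [Real.lt_sqrt] <;> norm_num))
  set c : ℕ → ℝ := fun k => D * (2 : ℝ)⁻¹ ^ k + 2 * B * (√2)⁻¹ ^ k with hc
  have hcs : Summable c := (hgeo1.mul_left D).add (hgeo2.mul_left (2 * B))
  have hcn : ∀ k, 0 ≤ c k := fun k => by simp only [hc]; positivity
  set e : ℝ → ℕ → ℝ := fun t k => if t ≤ 2 ^ k then (2 : ℝ)⁻¹ ^ k else 0 with he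
  have hen : ∀ t k, 0 ≤ e t k := fun t k => by
    simp only [he]; split_ifs <;> positivity
  -- In the constant, `2` is the loss from rounding `t > 1` up to a power of two, and `r⁻¹` covers
  -- the zeros of modulus at most `1`.
  have hdom : ∀ t : ℝ, r ≤ t → ∃ k, t⁻¹ ≤ (2 + r⁻¹) * e t k := by
    intro t ht
    have htpos : 0 < t := hr.trans_le ht
    by_cases h1 : t ≤ 1
    · refine ⟨0, ?_⟩
      simp only [he, pow_zero, if_pos h1, mul_one]
      have := inv_anti₀ hr ht
      linarith
    · push Not at h1
      obtain ⟨k, hk1, hk2⟩ := exists_nat_pow_near h1.le (by norm_num : (1 : ℝ) < 2)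
      refine ⟨k + 1, ?_⟩
      simp only [he, if_pos hk2.le]
      have h2 : t⁻¹ ≤ (2 ^ k)⁻¹ := inv_anti₀ (by positivity) hk1
      calc t⁻¹ ≤ (2 ^ k)⁻¹ := h2
        _ = 2 * (2 : ℝ)⁻¹ ^ (k + 1) := by rw [pow_succ, inv_pow]; ring
        _ ≤ (2 + r⁻¹) * (2 : ℝ)⁻¹ ^ (k + 1) := by
          gcongr
          have := inv_pos.2 hr
          linarith
  have hdom' : ∀ a : {a : ℂ // f a = 0}, ∃ k, ‖(a : ℂ)‖⁻¹ ≤ (2 + r⁻¹) * e ‖(a : ℂ)‖ k :=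
    fun a => hdom _ (hball _ a.2)
  choose κ hκ using hdom'
  refine summable_of_sum_le (c := (2 + r⁻¹) * ∑' k, c k) (fun _ => by positivity) fun u => ?_
  obtain ⟨N, hN⟩ : ∃ N, ∀ a ∈ u, κ a < N := by
    refine ⟨u.sup κ + 1, fun a ha => Nat.lt_succ_of_le (Finset.le_sup ha)⟩
  calc ∑ a ∈ u, ‖(a : ℂ)‖⁻¹
      ≤ ∑ a ∈ u, (2 + r⁻¹) * ∑ k ∈ Finset.range N, e ‖(a : ℂ)‖ k := by
        refine Finset.sum_le_sum fun a ha => (hκ a).trans ?_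
        gcongr
        exact Finset.single_le_sum (fun k _ => hen _ k) (Finset.mem_range.2 (hN a ha))
    _ = (2 + r⁻¹) * ∑ k ∈ Finset.range N, ∑ a ∈ u, e ‖(a : ℂ)‖ k := by
        rw [← Finset.mul_sum, Finset.sum_comm]
    _ ≤ (2 + r⁻¹) * ∑ k ∈ Finset.range N, c k := by
        gcongr with k hk
        simp only [he]
        rw [← Finset.sum_filter, Finset.sum_const, nsmul_eq_mul]
        set S := (u.filter fun a : {a : ℂ // f a = 0} => ‖(a : ℂ)‖ ≤ 2 ^ k).map
          (Function.Embedding.subtype _) with hS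
        have hcard : (S.card : ℝ) ≤ D + 2 * B * √(2 ^ k) := by
          refine card_zeros_le hf h0 hgr (by positivity) fun a ha => ?_
          simp only [hS, Finset.mem_map, Finset.mem_filter] at ha
          obtain ⟨b, ⟨-, hb⟩, rfl⟩ := ha
          exact ⟨b.2, hb⟩
        rw [hS, Finset.card_map] at hcard
        calc _ ≤ (D + 2 * B * √(2 ^ k)) * (2 : ℝ)⁻¹ ^ k := by gcongr
          _ = c k := by
            have h3 : √((2 : ℝ) ^ k) = √2 ^ k := by
              rw [Real.sqrt_eq_iff_mul_self_eq (by positivity) (by positivity), ← mul_pow]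
              simp
            have h4 : √(2 : ℝ) ^ k * (2 : ℝ)⁻¹ ^ k = (√2)⁻¹ ^ k := by
              rw [← mul_pow]
              congr 1
              have h5 : √(2 : ℝ) * √2 = 2 := Real.mul_self_sqrt (by norm_num)
              have h6 : √(2 : ℝ) ≠ 0 := by positivity
              field_simp
              nlinarith
            simp only [hc]
            rw [h3, add_mul, mul_assoc (2 * B), h4]
    _ ≤ (2 + r⁻¹) * ∑' k, c k := by
        gcongr
        exact hcs.sum_le_tsum _ fun k _ => hcn k

/-- The quotient of `f` by the product over its zeros in a disc is the exponential of a small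
number at a fixed point of the disc. -/
lemma norm_quotient_log_le (hf : Differentiable ℂ f) (h0 : f 0 = 1) (hB : 0 ≤ B) (hD : 0 < D)
    (hgr : ∀ z, ‖f z‖ ≤ Real.exp (D + B * √‖z‖))
    (hsimple : ∀ z, f z = 0 → deriv f z ≠ 0) {R : ℝ} (hR : 0 < R) {S : Finset ℂ}
    (hS : ∀ a, a ∈ S ↔ f a = 0 ∧ ‖a‖ ≤ R) {z : ℂ} (hz : ‖z‖ < R) :
    ∃ L : ℂ, ‖L‖ ≤ 2 * (D + 2 * B * √R) * ‖z‖ / (R - ‖z‖) ∧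
      f z = (∏ a ∈ S, (1 - z / a)) * exp L := by
  obtain ⟨g, hg, hfg⟩ := exists_eq_prod_mul hf (by simp [h0]) S fun a ha => ((hS a).1 ha).1
  have hg0 : g 0 = 1 := by simpa [h0] using (hfg 0).symm
  have hne0 : ∀ a ∈ S, a ≠ 0 := by
    rintro a ha rfl
    simpa [h0] using ((hS 0).1 ha).1
  -- A zero of `g` in the disc is a zero of `f`, hence already removed once by the product. It would
  -- be a double zero of `f`.
  have hgne : ∀ w ∈ ball (0 : ℂ) R, g w ≠ 0 := by
    intro w hw hgw
    have hfw : f w = 0 := by rw [hfg, hgw, mul_zero]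
    have hwS : w ∈ S := (hS w).2 ⟨hfw, (mem_ball_zero_iff.1 hw).le⟩
    apply hsimple w hfw
    have hP : Differentiable ℂ fun z => ∏ a ∈ S, (1 - z / a) := by fun_prop
    have hPw : ∏ a ∈ S, (1 - w / a) = 0 :=
      Finset.prod_eq_zero hwS (by rw [div_self (hne0 w hwS), sub_self])
    have h1 := (hP w).hasDerivAt.mul (hg w).hasDerivAt
    have h2 : f = (fun z => ∏ a ∈ S, (1 - z / a)) * g := funext hfg
    rw [h2, h1.deriv, hgw, hPw]
    simp
  obtain ⟨L, hL, hL0, hexp⟩ := exists_log_of_ne_zero hR hg.differentiableOn hgne hg0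
  have hzR : z ∈ ball (0 : ℂ) R := mem_ball_zero_iff.2 hz
  -- Borel–Carathéodory needs only an upper bound for `Re L = log |g|`, which the bound on `g`
  -- supplies after discarding `3 ^ card ≥ 1`. The estimate is `O(√R / R)`.
  refine ⟨L z, borelCaratheodory_zero (by positivity) hL (fun w hw => ?_) hR hzR hL0, ?_⟩
  · have h1 := pow_card_mul_norm_le hgr hR
      (fun a ha => ⟨hne0 a ha, ((hS a).1 ha).2⟩) hg hfg (mem_ball_zero_iff.1 hw).le
    have h2 : ‖g w‖ ≤ 3 ^ S.card * ‖g w‖ :=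
      le_mul_of_one_le_left (norm_nonneg _) (one_le_pow₀ (by norm_num))
    rw [← hexp w hw, norm_exp] at h2
    rw [← hexp w hw, norm_exp] at h1
    exact Real.exp_le_exp.1 (h2.trans h1)
  · rw [hexp z hzR, hfg]

/-- Hadamard factorization without exponential factor: an entire function with simple zeros,
normalized at the origin, of growth `exp (O (√|z|))`, is the product over its zeros. -/
theorem hasProd_zeros (hf : Differentiable ℂ f) (h0 : f 0 = 1) (hB : 0 ≤ B) (hD : 0 < D)
    (hgr : ∀ z, ‖f z‖ ≤ Real.exp (D + B * √‖z‖))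
    (hsimple : ∀ z, f z = 0 → deriv f z ≠ 0) (z : ℂ) :
    HasProd (fun a : {a : ℂ // f a = 0} => 1 - z / (a : ℂ)) (f z) := by
  classical
  have hmul : Multipliable fun a : {a : ℂ // f a = 0} => 1 - z / (a : ℂ) := by
    have h1 : Summable fun a : {a : ℂ // f a = 0} => ‖-(z / (a : ℂ))‖ := by
      simpa [div_eq_mul_inv] using (summable_inv_zeros hf h0 hB hD.le hgr).mul_left ‖z‖
    simpa [sub_eq_add_neg] using multipliable_one_add_of_summable h1
  have hfin : ∀ n : ℕ, {a : ℂ | f a = 0 ∧ ‖a‖ ≤ n + 1}.Finite :=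
    fun n => finite_zeros hf h0 hgr (by positivity)
  set S : ℕ → Finset ℂ := fun n => (hfin n).toFinset with hSdef
  have hS : ∀ n a, a ∈ S n ↔ f a = 0 ∧ ‖a‖ ≤ n + 1 := fun n a => by simp [hSdef]
  set T : ℕ → Finset {a : ℂ // f a = 0} := fun n => (S n).subtype _ with hT
  have hTprod : ∀ n, ∏ a ∈ T n, (1 - z / (a : ℂ)) = ∏ a ∈ S n, (1 - z / a) := by
    intro n
    exact Finset.prod_subtype_of_mem (fun a => 1 - z / a) fun a ha => ((hS n a).1 ha).1
  have hTtop : Tendsto T atTop atTop := by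
    refine tendsto_atTop_finset_of_monotone (fun m n hmn a ha => ?_) fun a => ?_
    · simp only [hT, Finset.mem_subtype, hS] at ha ⊢
      have : (m : ℝ) ≤ n := by exact_mod_cast hmn
      exact ⟨ha.1, by linarith⟩
    · obtain ⟨n, hn⟩ := exists_nat_ge ‖(a : ℂ)‖
      refine ⟨n, ?_⟩
      simp only [hT, Finset.mem_subtype, hS]
      exact ⟨a.2, by linarith⟩
  have hlim1 : Tendsto (fun n => ∏ a ∈ S n, (1 - z / a)) atTop
      (𝓝 (∏' a : {a : ℂ // f a = 0}, (1 - z / (a : ℂ)))) := by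
    simpa only [Function.comp_def, hTprod] using hmul.hasProd.comp hTtop
  have hex : ∀ n : ℕ, ∃ L : ℂ, ‖z‖ < n + 1 →
      ‖L‖ ≤ 2 * (D + 2 * B * √(n + 1)) * ‖z‖ / ((n + 1) - ‖z‖) ∧
      f z = (∏ a ∈ S n, (1 - z / a)) * exp L := by
    intro n
    by_cases hz : ‖z‖ < n + 1
    · obtain ⟨L, hL⟩ := norm_quotient_log_le hf h0 hB hD hgr hsimple
        (by positivity : (0 : ℝ) < n + 1) (hS n) hz
      exact ⟨L, fun _ => hL⟩
    · exact ⟨0, fun h => absurd h hz⟩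
  choose L hL using hex
  have hev : ∀ᶠ n : ℕ in atTop, ‖z‖ < n + 1 := by
    filter_upwards [eventually_ge_atTop ⌈‖z‖⌉₊] with n hn
    have := Nat.ceil_le.1 hn
    linarith
  have hbound : Tendsto
      (fun n : ℕ => 2 * (D + 2 * B * √((n : ℝ) + 1)) * ‖z‖ / (((n : ℝ) + 1) - ‖z‖))
      atTop (𝓝 0) := by
    have hcast : Tendsto (fun n : ℕ => √((n : ℝ) + 1)) atTop atTop :=
      Real.tendsto_sqrt_atTop.comp
        (tendsto_atTop_add_const_right _ _ tendsto_natCast_atTop_atTop)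
    have hinv : Tendsto (fun n : ℕ => (√((n : ℝ) + 1))⁻¹) atTop (𝓝 0) :=
      tendsto_inv_atTop_zero.comp hcast
    -- Numerator and denominator are divided by `n + 1`, so that everything depends on `1 / √(n + 1)
    -- → 0`.
    have h1 : Tendsto (fun n : ℕ => 2 * (D * (√((n : ℝ) + 1))⁻¹ ^ 2 +
        2 * B * (√((n : ℝ) + 1))⁻¹) * ‖z‖ / (1 - ‖z‖ * (√((n : ℝ) + 1))⁻¹ ^ 2))
        atTop (𝓝 (2 * (D * 0 ^ 2 + 2 * B * 0) * ‖z‖ / (1 - ‖z‖ * 0 ^ 2))) := by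
      refine Tendsto.div ?_ ?_ (by norm_num)
      · exact ((((hinv.pow 2).const_mul D).add (hinv.const_mul (2 * B))).const_mul 2).mul_const _
      · exact tendsto_const_nhds.sub ((hinv.pow 2).const_mul _)
    simp only [ne_eq, OfNat.ofNat_ne_zero, not_false_eq_true, zero_pow, mul_zero, add_zero,
      zero_mul, zero_div] at h1
    refine h1.congr fun n => ?_
    have hs : 0 < √((n : ℝ) + 1) := Real.sqrt_pos.2 (by positivity)
    have hsq : √((n : ℝ) + 1) ^ 2 = n + 1 := Real.sq_sqrt (by positivity)
    nth_rewrite 5 [← hsq]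
    set t := √((n : ℝ) + 1)
    rw [show 1 - ‖z‖ * t⁻¹ ^ 2 = (t ^ 2 - ‖z‖) / t ^ 2 by field_simp,
      show 2 * (D * t⁻¹ ^ 2 + 2 * B * t⁻¹) * ‖z‖ = 2 * (D + 2 * B * t) * ‖z‖ / t ^ 2 by
        field_simp, div_div_div_cancel_right₀ (by positivity)]
  have hL0 : Tendsto L atTop (𝓝 0) := by
    refine squeeze_zero_norm' ?_ hbound
    filter_upwards [hev] with n hn using (hL n hn).1
  have hlim2 : Tendsto (fun n => (∏ a ∈ S n, (1 - z / a)) * exp (L n)) atTop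
      (𝓝 ((∏' a : {a : ℂ // f a = 0}, (1 - z / (a : ℂ))) * exp 0)) :=
    hlim1.mul ((Complex.continuous_exp.tendsto 0).comp hL0)
  have hlim3 : Tendsto (fun n => (∏ a ∈ S n, (1 - z / a)) * exp (L n)) atTop (𝓝 (f z)) := by
    refine tendsto_const_nhds.congr' ?_
    filter_upwards [hev] with n hn using (hL n hn).2
  have h := tendsto_nhds_unique hlim2 hlim3
  rw [Complex.exp_zero, mul_one] at h
  exact h ▸ hmul.hasProd

end Growth

end ThirdOrder

end

noncomputable section

namespace ThirdOrder

open Filter Topology ComplexConjugate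

/-! ### Absolutely continuous functions on `[0, l]` -/

/-- Integration by parts for absolutely continuous functions, with Lebesgue differentiation
identifying the derivatives almost everywhere. This form is needed because `q` is not continuous. -/
lemma integral_mul_integral_real {f g : ℝ → ℝ} {x : ℝ}
    (hf : IntervalIntegrable f volume 0 x) (hg : IntervalIntegrable g volume 0 x) :
    IntervalIntegrable (fun t => f t * (∫ r in (0 : ℝ)..t, g r) + (∫ r in (0 : ℝ)..t, f r) * g t)
      volume 0 x ∧
    ∫ t in (0 : ℝ)..x, (f t * (∫ r in (0 : ℝ)..t, g r) + (∫ r in (0 : ℝ)..t, f r) * g t) =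
      (∫ t in (0 : ℝ)..x, f t) * ∫ t in (0 : ℝ)..x, g t := by
  have hF := hf.absolutelyContinuousOnInterval_intervalIntegral (c := 0) (by simp)
  have hG := hg.absolutelyContinuousOnInterval_intervalIntegral (c := 0) (by simp)
  refine ⟨(hf.mul_continuousOn hG.continuousOn).add (hg.continuousOn_mul hF.continuousOn), ?_⟩
  have h := hF.integral_deriv_mul_eq_sub hG
  simp only [intervalIntegral.integral_same, mul_zero, sub_zero] at h
  rw [← h]
  refine intervalIntegral.integral_congr_ae ?_
  filter_upwards [hf.ae_hasDerivAt_integral, hg.ae_hasDerivAt_integral] with t h1 h2 ht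
  rw [(h1 (uIoc_subset_uIcc ht) 0 (by simp)).deriv, (h2 (uIoc_subset_uIcc ht) 0 (by simp)).deriv]

lemma integral_mul_integral {f g : ℝ → ℂ} {x : ℝ}
    (hf : IntervalIntegrable f volume 0 x) (hg : IntervalIntegrable g volume 0 x) :
    ∫ t in (0 : ℝ)..x, (f t * (∫ r in (0 : ℝ)..t, g r) + (∫ r in (0 : ℝ)..t, f r) * g t) =
      (∫ t in (0 : ℝ)..x, f t) * ∫ t in (0 : ℝ)..x, g t := by
  have hsub : ∀ {k : ℝ → ℂ}, IntervalIntegrable k volume 0 x → ∀ t ∈ uIcc 0 x,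
      IntervalIntegrable k volume 0 t := fun hk t ht =>
    hk.mono_set (uIcc_subset_uIcc_left ht)
  have hre : ∀ {k : ℝ → ℂ}, IntervalIntegrable k volume 0 x → ∀ t ∈ uIcc 0 x,
      (∫ r in (0 : ℝ)..t, k r).re = ∫ r in (0 : ℝ)..t, (k r).re := fun hk t ht =>
    (reCLM.intervalIntegral_comp_comm (hsub hk t ht)).symm
  have him : ∀ {k : ℝ → ℂ}, IntervalIntegrable k volume 0 x → ∀ t ∈ uIcc 0 x,
      (∫ r in (0 : ℝ)..t, k r).im = ∫ r in (0 : ℝ)..t, (k r).im := fun hk t ht =>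
    (imCLM.intervalIntegral_comp_comm (hsub hk t ht)).symm
  have hx : x ∈ uIcc 0 x := right_mem_uIcc
  have hire : ∀ {k : ℝ → ℂ}, IntervalIntegrable k volume 0 x →
      IntervalIntegrable (fun t => (k t).re) volume 0 x := fun hk => ⟨hk.1.re, hk.2.re⟩
  have hiim : ∀ {k : ℝ → ℂ}, IntervalIntegrable k volume 0 x →
      IntervalIntegrable (fun t => (k t).im) volume 0 x := fun hk => ⟨hk.1.im, hk.2.im⟩
  have hF : ContinuousOn (fun t => ∫ r in (0 : ℝ)..t, f r) (uIcc 0 x) :=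
    intervalIntegral.continuousOn_primitive_interval' hf left_mem_uIcc
  have hG : ContinuousOn (fun t => ∫ r in (0 : ℝ)..t, g r) (uIcc 0 x) :=
    intervalIntegral.continuousOn_primitive_interval' hg left_mem_uIcc
  have hint := (hf.mul_continuousOn hG).add (hg.continuousOn_mul hF)
  have hrr := integral_mul_integral_real (hire hf) (hire hg)
  have hii := integral_mul_integral_real (hiim hf) (hiim hg)
  have hri := integral_mul_integral_real (hire hf) (hiim hg)
  have hir := integral_mul_integral_real (hiim hf) (hire hg)
  apply Complex.ext
  · rw [hre hint x hx, mul_re, hre hf x hx, hre hg x hx, him hf x hx, him hg x hx, ← hrr.2,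
      ← hii.2, ← intervalIntegral.integral_sub hrr.1 hii.1]
    refine intervalIntegral.integral_congr fun t ht => ?_
    simp only [add_re, mul_re]
    rw [hre hf t ht, hre hg t ht, him hf t ht, him hg t ht]
    ring
  · rw [him hint x hx, mul_im, hre hf x hx, hre hg x hx, him hf x hx, him hg x hx, ← hri.2,
      ← hir.2, ← intervalIntegral.integral_add hri.1 hir.1]
    refine intervalIntegral.integral_congr fun t ht => ?_
    simp only [add_im, mul_im]
    rw [hre hf t ht, hre hg t ht, him hf t ht, him hg t ht]
    ring

/-- `F` is an indefinite integral of the integrable function `f` on `[0, l]`. -/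
structure IsPrimitiveOn (l : ℝ) (F f : ℝ → ℂ) : Prop where
  nonneg : 0 ≤ l
  integrable : IntervalIntegrable f volume 0 l
  eq : ∀ x ∈ Icc 0 l, F x = F 0 + ∫ t in (0 : ℝ)..x, f t

/-! ### Calculus of indefinite integrals: sums, conjugates, products, and the link with one-sided
derivatives. -/

namespace IsPrimitiveOn

variable {l : ℝ} {F G f g : ℝ → ℂ}

lemma integrable_of_mem (hF : IsPrimitiveOn l F f) {x : ℝ} (hx : x ∈ Icc 0 l) :
    IntervalIntegrable f volume 0 x :=
  hF.integrable.mono_set (by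
    rw [uIcc_of_le hx.1, uIcc_of_le (hx.1.trans hx.2)]
    exact Icc_subset_Icc le_rfl hx.2)

lemma continuousOn (hF : IsPrimitiveOn l F f) : ContinuousOn F (Icc 0 l) := by
  have h := intervalIntegral.continuousOn_primitive_interval' hF.integrable left_mem_uIcc
  rw [uIcc_of_le hF.nonneg] at h
  exact (continuousOn_const.add h).congr hF.eq

lemma congr (hF : IsPrimitiveOn l F f) {F' f' : ℝ → ℂ} (h1 : ∀ x, F' x = F x)
    (h2 : ∀ x, f' x = f x) : IsPrimitiveOn l F' f' := by
  rw [funext h1, funext h2]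
  exact hF

lemma add (hF : IsPrimitiveOn l F f) (hG : IsPrimitiveOn l G g) :
    IsPrimitiveOn l (fun x => F x + G x) (fun x => f x + g x) where
  nonneg := hF.nonneg
  integrable := hF.integrable.add hG.integrable
  eq x hx := by
    rw [intervalIntegral.integral_add (hF.integrable_of_mem hx) (hG.integrable_of_mem hx),
      hF.eq x hx, hG.eq x hx]
    ring

lemma const_mul (hF : IsPrimitiveOn l F f) (c : ℂ) :
    IsPrimitiveOn l (fun x => c * F x) (fun x => c * f x) where
  nonneg := hF.nonneg
  integrable := hF.integrable.const_mul c
  eq x hx := by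
    rw [intervalIntegral.integral_const_mul, hF.eq x hx]
    ring

lemma sub (hF : IsPrimitiveOn l F f) (hG : IsPrimitiveOn l G g) :
    IsPrimitiveOn l (fun x => F x - G x) (fun x => f x - g x) :=
  (hF.add (hG.const_mul (-1))).congr (fun x => by ring) (fun x => by ring)

lemma star (hF : IsPrimitiveOn l F f) :
    IsPrimitiveOn l (fun x => conj (F x)) (fun x => conj (f x)) where
  nonneg := hF.nonneg
  integrable :=
    ⟨conjCLE.toContinuousLinearMap.integrable_comp hF.integrable.1,
      conjCLE.toContinuousLinearMap.integrable_comp hF.integrable.2⟩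
  eq x hx := by
    have := conjCLE.toContinuousLinearMap.intervalIntegral_comp_comm (hF.integrable_of_mem hx)
    simp only [ContinuousLinearEquiv.coe_coe, conjCLE_apply] at this
    rw [this, hF.eq x hx, map_add]

/-- The product rule. -/
lemma mul (hF : IsPrimitiveOn l F f) (hG : IsPrimitiveOn l G g) :
    IsPrimitiveOn l (fun x => F x * G x) (fun x => f x * G x + F x * g x) := by
  have hsub : uIcc 0 l = Icc 0 l := uIcc_of_le hF.nonneg
  have hFc : ContinuousOn F (uIcc 0 l) := hsub ▸ hF.continuousOn
  have hGc : ContinuousOn G (uIcc 0 l) := hsub ▸ hG.continuousOn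
  refine ⟨hF.nonneg, (hF.integrable.mul_continuousOn hGc).add (hG.integrable.continuousOn_mul hFc), ?_⟩
  intro x hx
  have hfx := hF.integrable_of_mem hx
  have hgx := hG.integrable_of_mem hx
  have hx0 : uIcc 0 x ⊆ Icc 0 l := by
    rw [uIcc_of_le hx.1]
    exact Icc_subset_Icc le_rfl hx.2
  have h1 := integral_mul_integral hfx hgx
  have h2 : ∫ t in (0 : ℝ)..x, (f t * G t + F t * g t) =
      ∫ t in (0 : ℝ)..x, ((f t * (∫ r in (0 : ℝ)..t, g r) + (∫ r in (0 : ℝ)..t, f r) * g t) +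
        (G 0 * f t + F 0 * g t)) := by
    refine intervalIntegral.integral_congr fun t ht => ?_
    rw [hF.eq t (hx0 ht), hG.eq t (hx0 ht)]
    ring
  have hFi : ContinuousOn (fun t => ∫ r in (0 : ℝ)..t, f r) (uIcc 0 x) :=
    intervalIntegral.continuousOn_primitive_interval' hfx left_mem_uIcc
  have hGi : ContinuousOn (fun t => ∫ r in (0 : ℝ)..t, g r) (uIcc 0 x) :=
    intervalIntegral.continuousOn_primitive_interval' hgx left_mem_uIcc
  rw [h2, intervalIntegral.integral_add
    ((hfx.mul_continuousOn hGi).add (hgx.continuousOn_mul hFi))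
    ((hfx.const_mul _).add (hgx.const_mul _)), h1,
    intervalIntegral.integral_add (hfx.const_mul _) (hgx.const_mul _),
    intervalIntegral.integral_const_mul, intervalIntegral.integral_const_mul,
    hF.eq x hx, hG.eq x hx]
  ring

lemma of_hasDerivWithinAt (h : ∀ x ∈ Icc 0 l, HasDerivWithinAt F (f x) (Icc 0 l) x)
    (hl : 0 ≤ l) (hf : ContinuousOn f (Icc 0 l)) : IsPrimitiveOn l F f where
  nonneg := hl
  integrable := (hf.mono (uIcc_of_le hl).subset).intervalIntegrable
  eq x hx := by
    have hsub : Icc 0 x ⊆ Icc 0 l := Icc_subset_Icc le_rfl hx.2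
    rw [intervalIntegral.integral_eq_sub_of_hasDerivAt_of_le hx.1
      (fun t ht => ((h t (hsub ht)).continuousWithinAt.mono hsub))
      (fun t ht => (h t (hsub (Ioo_subset_Icc_self ht))).hasDerivAt
        (Icc_mem_nhds ht.1 (ht.2.trans_le hx.2)))
      ((hf.mono ((uIcc_of_le hx.1).subset.trans hsub)).intervalIntegrable)]
    ring

lemma hasDerivWithinAt (hF : IsPrimitiveOn l F f) (hf : ContinuousOn f (Icc 0 l))
    {x : ℝ} (hx : x ∈ Icc 0 l) : HasDerivWithinAt F (f x) (Icc 0 l) x := by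
  have : Fact (x ∈ Icc 0 l) := ⟨hx⟩
  have h := intervalIntegral.integral_hasDerivWithinAt_right (hF.integrable_of_mem hx)
    (s := Icc 0 l) (t := Icc 0 l)
    (hf.stronglyMeasurableAtFilter_nhdsWithin measurableSet_Icc x) (hf x hx)
  exact (h.const_add (F 0)).congr hF.eq (hF.eq x hx)

end IsPrimitiveOn

/-! ### Identities for solutions -/

namespace IsCauchySolution

variable {q : ℝ → ℝ} {l : ℝ} {lam mu : ℂ} {c d : Fin 3 → ℂ} {Y W : Fin 3 → ℝ → ℂ}

lemma continuousOn_zero (hY : IsCauchySolution q l lam c Y) : ContinuousOn (Y 0) (Icc 0 l) :=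
  fun x hx => (hY.deriv_zero x hx).continuousWithinAt

lemma continuousOn_one (hY : IsCauchySolution q l lam c Y) : ContinuousOn (Y 1) (Icc 0 l) :=
  fun x hx => (hY.deriv_one x hx).continuousWithinAt

lemma init_two (hY : IsCauchySolution q l lam c Y) (hl : 0 < l) : Y 2 0 = c 2 := by
  have h := hY.equation 0 ⟨le_rfl, hl.le⟩
  rw [intervalIntegral.integral_same] at h
  have := (mul_eq_zero.1 h).resolve_left I_ne_zero
  exact sub_eq_zero.1 this

lemma intervalIntegrable_coeff_mul (hl : 0 < l) (hq : IntervalIntegrable q volume 0 l)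
    (z : ℂ) {y : ℝ → ℂ} (hy : ContinuousOn y (Icc 0 l)) :
    IntervalIntegrable (fun t => (z - (q t : ℂ)) * y t) volume 0 l := by
  have hqc : IntervalIntegrable (fun t => (q t : ℂ)) volume 0 l := ⟨hq.1.ofReal, hq.2.ofReal⟩
  exact (intervalIntegrable_const.sub hqc).mul_continuousOn (by rwa [uIcc_of_le hl.le])

lemma primitive_two (hY : IsCauchySolution q l lam c Y) (hl : 0 < l)
    (hq : IntervalIntegrable q volume 0 l) :
    IsPrimitiveOn l (Y 2) (fun t => -I * ((lam ^ 3 - (q t : ℂ)) * Y 0 t)) where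
  nonneg := hl.le
  integrable := (intervalIntegrable_coeff_mul hl hq _ hY.continuousOn_zero).const_mul _
  eq x hx := by
    rw [intervalIntegral.integral_const_mul, ← hY.equation x hx, hY.init_two hl]
    linear_combination (Y 2 x - c 2) * I_sq

lemma continuousOn_two (hY : IsCauchySolution q l lam c Y) (hl : 0 < l)
    (hq : IntervalIntegrable q volume 0 l) : ContinuousOn (Y 2) (Icc 0 l) :=
  (hY.primitive_two hl hq).continuousOn

lemma primitive_zero (hY : IsCauchySolution q l lam c Y) (hl : 0 < l) :
    IsPrimitiveOn l (Y 0) (Y 1) :=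
  .of_hasDerivWithinAt hY.deriv_zero hl.le hY.continuousOn_one

lemma primitive_one (hY : IsCauchySolution q l lam c Y) (hl : 0 < l)
    (hq : IntervalIntegrable q volume 0 l) : IsPrimitiveOn l (Y 1) (Y 2) :=
  .of_hasDerivWithinAt hY.deriv_one hl.le (hY.continuousOn_two hl hq)

lemma of_primitive (h0 : IsPrimitiveOn l (Y 0) (Y 1))
    (h1 : IsPrimitiveOn l (Y 1) (Y 2))
    (h2 : IsPrimitiveOn l (Y 2) (fun t => -I * ((lam ^ 3 - (q t : ℂ)) * Y 0 t)))
    (hc : ∀ j, Y j 0 = c j) : IsCauchySolution q l lam c Y where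
  deriv_zero _ hx := h0.hasDerivWithinAt h1.continuousOn hx
  deriv_one _ hx := h1.hasDerivWithinAt h2.continuousOn hx
  equation x hx := by
    rw [h2.eq x hx, hc 2, intervalIntegral.integral_const_mul]
    linear_combination (-∫ t in (0 : ℝ)..x, (lam ^ 3 - (q t : ℂ)) * Y 0 t) * I_sq
  init_zero := hc 0
  init_one := hc 1

lemma init (hY : IsCauchySolution q l lam c Y) (hl : 0 < l) (j : Fin 3) : Y j 0 = c j := by
  fin_cases j
  · exact hY.init_zero
  · exact hY.init_one
  · exact hY.init_two hl

lemma lin_comb (hl : 0 < l) (hq : IntervalIntegrable q volume 0 l)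
    (hY : IsCauchySolution q l lam c Y) (hW : IsCauchySolution q l lam d W) (α β : ℂ) :
    IsCauchySolution q l lam (fun j => α * c j + β * d j)
      (fun j x => α * Y j x + β * W j x) := by
  refine of_primitive
    (((hY.primitive_zero hl).const_mul α).add ((hW.primitive_zero hl).const_mul β))
    (((hY.primitive_one hl hq).const_mul α).add ((hW.primitive_one hl hq).const_mul β))
    ((((hY.primitive_two hl hq).const_mul α).add ((hW.primitive_two hl hq).const_mul β)).congr
      (fun _ => rfl) fun x => by ring) fun j => by rw [hY.init hl, hW.init hl]

/-- The Lagrange identity. -/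
lemma lagrange (hl : 0 < l) (hq : IntervalIntegrable q volume 0 l)
    (hY : IsCauchySolution q l lam c Y) (hW : IsCauchySolution q l mu d W) :
    IsPrimitiveOn l
      (fun x => Y 2 x * conj (W 0 x) - Y 1 x * conj (W 1 x) + Y 0 x * conj (W 2 x))
      (fun x => -I * (lam ^ 3 - conj (mu ^ 3)) * (Y 0 x * conj (W 0 x))) := by
  refine ((((hY.primitive_two hl hq).mul (hW.primitive_zero hl).star).sub
    ((hY.primitive_one hl hq).mul (hW.primitive_one hl hq).star)).add
    ((hY.primitive_zero hl).mul (hW.primitive_two hl hq).star)).congr (fun x => rfl) fun x => ?_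
  -- Because `q` is real, its two contributions cancel. The mixed products of derivatives cancel
  -- too.
  simp only [map_mul, map_neg, map_sub, conj_I, conj_ofReal]
  ring

/-- Two-by-two minors of solutions solve the adjoint equation. -/
lemma wedge (hl : 0 < l) (hq : IntervalIntegrable q volume 0 l)
    (hY : IsCauchySolution q l lam c Y) (hW : IsCauchySolution q l lam d W) :
    IsCauchySolution q l (conj lam)
      ![conj (c 1 * d 0 - c 0 * d 1), conj (c 2 * d 0 - c 0 * d 2), conj (c 2 * d 1 - c 1 * d 2)]
      ![fun x => conj (Y 1 x * W 0 x - Y 0 x * W 1 x),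
        fun x => conj (Y 2 x * W 0 x - Y 0 x * W 2 x),
        fun x => conj (Y 2 x * W 1 x - Y 1 x * W 2 x)] := by
  have hY0 := hY.primitive_zero hl
  have hY1 := hY.primitive_one hl hq
  have hY2 := hY.primitive_two hl hq
  have hW0 := hW.primitive_zero hl
  have hW1 := hW.primitive_one hl hq
  have hW2 := hW.primitive_two hl hq
  refine of_primitive ?_ ?_ ?_ fun j => ?_
  · refine ((hY1.mul hW0).sub (hY0.mul hW1)).star.congr (fun _ => rfl) fun x => ?_
    simp only [Matrix.cons_val]
    congr 1
    ring
  · refine ((hY2.mul hW0).sub (hY0.mul hW2)).star.congr (fun _ => rfl) fun x => ?_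
    simp only [Matrix.cons_val]
    congr 1
    ring
  · refine ((hY2.mul hW1).sub (hY1.mul hW2)).star.congr (fun _ => rfl) fun x => ?_
    -- Differentiating the last minor gives `+i (λ³ - q)` times the first one. Conjugation restores
    -- the sign `-i` and leaves the real `q` alone.
    simp only [Matrix.cons_val, map_mul, map_neg, map_sub, map_add, conj_I, conj_ofReal, map_pow]
    ring
  · fin_cases j <;> simp [hY.init hl, hW.init hl]

/-- A solution that vanishes identically has vanishing initial data. -/
lemma init_eq_zero_of_eqOn_zero (hY : IsCauchySolution q l lam c Y) (hl : 0 < l)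
    (hvan : ∀ x ∈ Icc 0 l, Y 0 x = 0) : c 1 = 0 ∧ c 2 = 0 := by
  have hder : ∀ {k k' : ℝ → ℂ}, (∀ x ∈ Icc 0 l, HasDerivWithinAt k (k' x) (Icc 0 l) x) →
      (∀ x ∈ Icc 0 l, k x = 0) → ∀ x ∈ Icc 0 l, k' x = 0 := by
    intro k k' hk hk0 x hx
    have h1 : HasDerivWithinAt k 0 (Icc 0 l) x :=
      (hasDerivWithinAt_const x (Icc 0 l) (0 : ℂ)).congr hk0 (hk0 x hx)
    exact (uniqueDiffOn_Icc hl x hx).eq_deriv _ (hk x hx) h1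
  have h1 := hder hY.deriv_zero hvan
  have h2 := hder hY.deriv_one h1
  have h0 : (0 : ℝ) ∈ Icc 0 l := ⟨le_rfl, hl.le⟩
  exact ⟨hY.init hl 1 ▸ h1 0 h0, hY.init hl 2 ▸ h2 0 h0⟩

/-- If the boundary form of the initial data vanishes and `Im lam³ ≥ 0`, then `|y|²` is convex
along the solution, which therefore has no zero at `l`. -/
lemma ne_zero_of_im_nonneg (hl : 0 < l) (hq : IntervalIntegrable q volume 0 l)
    (hY : IsCauchySolution q l lam c Y) (hlam : 0 ≤ (lam ^ 3).im)
    (hc1 : c 1 = 0) (hc2 : c 2 ≠ 0) (hc : c 2 * conj (c 0) + c 0 * conj (c 2) = 0) :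
    Y 0 l ≠ 0 := by
  intro hzero
  have hY0 := hY.primitive_zero hl
  have hY1 := hY.primitive_one hl hq
  have hL := hY.lagrange hl hq hY
  have hN := hY0.mul hY0.star
  have hN' := (hY1.mul hY0.star).add (hY0.mul hY1.star)
  -- The form vanishes at `0` by `hc`, so at `x` it equals `2 Im λ³ ∫₀ˣ |y|²`.
  have hB : ∀ x ∈ Icc 0 l,
      0 ≤ (Y 2 x * conj (Y 0 x) - Y 1 x * conj (Y 1 x) + Y 0 x * conj (Y 2 x)).re := by
    intro x hx
    have h1 := hL.eq x hx
    simp only [hY.init hl, hc1] at h1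
    rw [zero_mul, sub_zero, hc, zero_add] at h1
    rw [h1, intervalIntegral.integral_const_mul]
    have h2 : ∫ t in (0 : ℝ)..x, Y 0 t * conj (Y 0 t) =
        ((∫ t in (0 : ℝ)..x, ‖Y 0 t‖ ^ 2 : ℝ) : ℂ) := by
      rw [← intervalIntegral.integral_ofReal]
      refine intervalIntegral.integral_congr fun t _ => ?_
      simp [mul_conj, normSq_eq_norm_sq]
    have h3 : -I * (lam ^ 3 - conj (lam ^ 3)) = ((2 * (lam ^ 3).im : ℝ) : ℂ) := by
      rw [sub_conj]
      push_cast
      linear_combination (-(2 * ((lam ^ 3).im : ℂ))) * I_sq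
    rw [h2, h3, ← ofReal_mul, ofReal_re]
    exact mul_nonneg (by linarith)
      (intervalIntegral.integral_nonneg hx.1 fun t _ => by positivity)
  have hre : ∀ {k : ℝ → ℂ} {a b : ℝ}, a ≤ b → IntervalIntegrable k volume a b →
      (∀ t ∈ Icc a b, 0 ≤ (k t).re) → 0 ≤ (∫ t in a..b, k t).re := by
    intro k a b hab hk hpos
    have h := reCLM.intervalIntegral_comp_comm hk
    simp only [reCLM_apply] at h
    rw [← h]
    exact intervalIntegral.integral_nonneg hab hpos
  -- `(|y|²)''` is the form just estimated plus `3 |y'|²`, and `c 1 = 0` makes the initial slope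
  -- zero.
  have hslope : ∀ x ∈ Icc 0 l, 0 ≤ (Y 1 x * conj (Y 0 x) + Y 0 x * conj (Y 1 x)).re := by
    intro x hx
    have h1 := hN'.eq x hx
    simp only [hY.init hl, hc1, zero_mul, map_zero, mul_zero, add_zero, zero_add] at h1
    rw [h1]
    refine hre hx.1 (hN'.integrable_of_mem hx) fun t ht => ?_
    have h2 := hB t ⟨ht.1, ht.2.trans hx.2⟩
    have h3 : Y 2 t * conj (Y 0 t) + Y 1 t * conj (Y 1 t) +
        (Y 1 t * conj (Y 1 t) + Y 0 t * conj (Y 2 t)) =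
        (Y 2 t * conj (Y 0 t) - Y 1 t * conj (Y 1 t) + Y 0 t * conj (Y 2 t)) +
          ((3 * normSq (Y 1 t) : ℝ) : ℂ) := by
      push_cast
      rw [← mul_conj]
      ring
    rw [h3, add_re, ofReal_re]
    have := normSq_nonneg (Y 1 t)
    linarith
  have hvan : ∀ x ∈ Icc 0 l, Y 0 x = 0 := by
    intro x hx
    have hll : l ∈ Icc 0 l := ⟨hl.le, le_rfl⟩
    have h1 := hN.eq x hx
    have h2 := hN.eq l hll
    have h3 := intervalIntegral.integral_add_adjacent_intervals (hN.integrable_of_mem hx)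
      ((hN.integrable_of_mem hx).symm.trans (hN.integrable_of_mem hll))
    have h4 := hre hx.2 ((hN.integrable_of_mem hx).symm.trans (hN.integrable_of_mem hll))
      fun t ht => hslope t ⟨hx.1.trans ht.1, ht.2⟩
    have h5 : Y 0 l * conj (Y 0 l) = Y 0 x * conj (Y 0 x) +
        ∫ t in x..l, (Y 1 t * conj (Y 0 t) + Y 0 t * conj (Y 1 t)) := by
      rw [h1, h2, ← h3]
      ring
    rw [hzero, zero_mul, mul_conj] at h5
    have h6 := congrArg re h5
    rw [add_re, ofReal_re, zero_re] at h6
    have h7 := normSq_nonneg (Y 0 x)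
    exact normSq_eq_zero.1 (by linarith)
  exact hc2 (hY.init_eq_zero_of_eqOn_zero hl hvan).2

end IsCauchySolution

end ThirdOrder

end

noncomputable section

namespace ThirdOrder

open Filter Topology ComplexConjugate

/-! ### Solvability of the Cauchy problem and dependence on the spectral parameter -/

section Volterra

variable {l : ℝ}

lemma volterra_integrable (hl : 0 ≤ l) (κ : ℝ) {w : ℝ → ℂ} (hw : IntervalIntegrable w volume 0 l)
    (f : C(Icc (0 : ℝ) l, ℂ)) :
    IntervalIntegrable (fun t => (Real.exp (κ * t) : ℂ) * (w t * IccExtend hl f t))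
      volume 0 l :=
  (hw.mul_continuousOn f.continuous.Icc_extend'.continuousOn).continuousOn_mul
    (by fun_prop)

lemma intervalIntegrable_of_mem_Icc {E : Type*} [NormedAddCommGroup E] {w : ℝ → E}
    (hw : IntervalIntegrable w volume 0 l) {x : ℝ} (hx : x ∈ Icc 0 l) :
    IntervalIntegrable w volume 0 x :=
  hw.mono_set (by
    rw [uIcc_of_le hx.1, uIcc_of_le (hx.1.trans hx.2)]
    exact Icc_subset_Icc le_rfl hx.2)

/-- The exponentially weighted Volterra operator
`f ↦ ∫₀ˣ exp (κ (t - x)) w(t) f(t) dt` as a continuous function of `x`. -/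
def volterraFun (hl : 0 ≤ l) (κ : ℝ) {w : ℝ → ℂ} (hw : IntervalIntegrable w volume 0 l)
    (f : C(Icc (0 : ℝ) l, ℂ)) : C(Icc (0 : ℝ) l, ℂ) where
  toFun x := (Real.exp (-(κ * x)) : ℂ) *
    ∫ t in (0 : ℝ)..x, (Real.exp (κ * t) : ℂ) * (w t * IccExtend hl f t)
  continuous_toFun := by
    have h := intervalIntegral.continuousOn_primitive_interval' (volterra_integrable hl κ hw f)
      left_mem_uIcc
    rw [uIcc_of_le hl, continuousOn_iff_continuous_domRestrict] at h
    refine Continuous.mul (by fun_prop) h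

lemma norm_volterraFun_apply_le (hl : 0 ≤ l) (κ : ℝ) {w : ℝ → ℂ}
    (hw : IntervalIntegrable w volume 0 l) (f : C(Icc (0 : ℝ) l, ℂ)) (x : Icc (0 : ℝ) l) :
    ‖volterraFun hl κ hw f x‖ ≤
      (∫ t in (0 : ℝ)..x, Real.exp (κ * (t - x)) * ‖w t‖) * ‖f‖ := by
  have hi : IntervalIntegrable (fun t => Real.exp (κ * (t - x)) * ‖w t‖) volume 0 x :=
    (intervalIntegrable_of_mem_Icc hw x.2).norm.continuousOn_mul (by fun_prop)
  change ‖(Real.exp (-(κ * x)) : ℂ) *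
    ∫ t in (0 : ℝ)..x, (Real.exp (κ * t) : ℂ) * (w t * IccExtend hl f t)‖ ≤ _
  rw [← intervalIntegral.integral_const_mul, ← intervalIntegral.integral_mul_const]
  refine intervalIntegral.norm_integral_le_of_norm_le x.2.1 ?_ (hi.mul_const _)
  refine Eventually.of_forall fun t _ => ?_
  rw [norm_mul, norm_mul, norm_mul, norm_real, norm_real, Real.norm_eq_abs, Real.norm_eq_abs,
    Real.abs_exp, Real.abs_exp, ← mul_assoc, ← Real.exp_add, ← mul_assoc,
    show -(κ * (x : ℝ)) + κ * t = κ * (t - x) by ring]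
  gcongr
  exact f.norm_coe_le_norm _

lemma norm_volterraFun_le (hl : 0 ≤ l) {κ : ℝ} (hκ : 0 ≤ κ) {w : ℝ → ℂ}
    (hw : IntervalIntegrable w volume 0 l) (f : C(Icc (0 : ℝ) l, ℂ)) :
    ‖volterraFun hl κ hw f‖ ≤ (∫ t in (0 : ℝ)..l, ‖w t‖) * ‖f‖ := by
  have hnn : 0 ≤ ∫ t in (0 : ℝ)..l, ‖w t‖ :=
    intervalIntegral.integral_nonneg hl fun _ _ => norm_nonneg _
  refine (ContinuousMap.norm_le _ (by positivity)).2 fun x => ?_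
  refine (norm_volterraFun_apply_le hl κ hw f x).trans ?_
  gcongr
  have hwx := (intervalIntegrable_of_mem_Icc hw x.2).norm
  calc ∫ t in (0 : ℝ)..x, Real.exp (κ * (t - x)) * ‖w t‖
      ≤ ∫ t in (0 : ℝ)..x, ‖w t‖ := by
        refine intervalIntegral.integral_mono_on x.2.1
          (hwx.continuousOn_mul (by fun_prop)) hwx fun t ht => ?_
        refine mul_le_of_le_one_left (norm_nonneg _) (Real.exp_le_one_iff.2 ?_)
        exact mul_nonpos_of_nonneg_of_nonpos hκ (by linarith [ht.2])
    _ ≤ ∫ t in (0 : ℝ)..l, ‖w t‖ := by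
        refine intervalIntegral.integral_mono_interval le_rfl x.2.1 x.2.2 ?_ hw.norm
        exact Eventually.of_forall fun _ => norm_nonneg _

/-- The weighted Volterra operator. -/
def volterra (hl : 0 ≤ l) {κ : ℝ} (hκ : 0 ≤ κ) {w : ℝ → ℂ}
    (hw : IntervalIntegrable w volume 0 l) : C(Icc (0 : ℝ) l, ℂ) →L[ℂ] C(Icc (0 : ℝ) l, ℂ) :=
  LinearMap.mkContinuous
    { toFun := volterraFun hl κ hw
      map_add' := fun f g => by
        ext x
        simp only [volterraFun, ContinuousMap.coe_mk, ContinuousMap.add_apply]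
        rw [← mul_add, ← intervalIntegral.integral_add
          (intervalIntegrable_of_mem_Icc (volterra_integrable hl κ hw f) x.2)
          (intervalIntegrable_of_mem_Icc (volterra_integrable hl κ hw g) x.2)]
        congr 1
        refine intervalIntegral.integral_congr fun t _ => ?_
        simp only [IccExtend, Function.comp_apply, ContinuousMap.add_apply]
        ring
      map_smul' := fun c f => by
        ext x
        simp only [volterraFun, ContinuousMap.coe_mk, ContinuousMap.smul_apply, RingHom.id_apply,
          smul_eq_mul]
        rw [mul_left_comm, ← intervalIntegral.integral_const_mul c]
        congr 1
        refine intervalIntegral.integral_congr fun t _ => ?_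
        simp only [IccExtend, Function.comp_apply, ContinuousMap.smul_apply, smul_eq_mul]
        ring }
    (∫ t in (0 : ℝ)..l, ‖w t‖) (norm_volterraFun_le hl hκ hw)

lemma volterra_apply (hl : 0 ≤ l) {κ : ℝ} (hκ : 0 ≤ κ) {w : ℝ → ℂ}
    (hw : IntervalIntegrable w volume 0 l) (f : C(Icc (0 : ℝ) l, ℂ)) (x : Icc (0 : ℝ) l) :
    volterra hl hκ hw f x = (Real.exp (-(κ * x)) : ℂ) *
      ∫ t in (0 : ℝ)..x, (Real.exp (κ * t) : ℂ) * (w t * IccExtend hl f t) := rfl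

lemma norm_volterra_le (hl : 0 ≤ l) {κ : ℝ} (hκ : 0 ≤ κ) {w : ℝ → ℂ}
    (hw : IntervalIntegrable w volume 0 l) :
    ‖volterra hl hκ hw‖ ≤ ∫ t in (0 : ℝ)..l, ‖w t‖ :=
  LinearMap.mkContinuous_norm_le _
    (intervalIntegral.integral_nonneg hl fun _ _ => norm_nonneg _) _

/-- The gain from the weight: `∫₀ˣ exp (κ (t - x)) dt ≤ 1 / κ`. -/
lemma norm_volterra_one_le (hl : 0 ≤ l) {κ : ℝ} (hκ : 0 < κ) :
    ‖volterra hl hκ.le (intervalIntegrable_const (μ := volume) (c := (1 : ℂ)))‖ ≤ κ⁻¹ := by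
  refine ContinuousLinearMap.opNorm_le_bound _ (by positivity) fun f => ?_
  refine (ContinuousMap.norm_le _ (by positivity)).2 fun x => ?_
  refine (norm_volterraFun_apply_le hl κ intervalIntegrable_const f x).trans ?_
  gcongr
  simp only [norm_one, mul_one]
  have hd : ∀ t ∈ uIcc (0 : ℝ) x,
      HasDerivAt (fun t => κ⁻¹ * Real.exp (κ * (t - x))) (Real.exp (κ * (t - x))) t := by
    intro t _
    have h1 : HasDerivAt (fun t => κ * (t - x)) κ t := by
      simpa using ((hasDerivAt_id t).sub_const (x : ℝ)).const_mul κ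
    refine (h1.exp.const_mul κ⁻¹).congr_deriv ?_
    field_simp
  rw [intervalIntegral.integral_eq_sub_of_hasDerivAt hd
    (Continuous.intervalIntegrable (by fun_prop) _ _)]
  simp only [sub_self, mul_zero, Real.exp_zero, mul_one]
  have : 0 ≤ κ⁻¹ * Real.exp (κ * (0 - x)) := by positivity
  linarith

end Volterra

/-! ### Neumann inversion and its analytic dependence on an affine parameter. -/

section Resolvent

variable {E : Type*} [NormedAddCommGroup E] [NormedSpace ℂ E] [CompleteSpace E]

/-- The solution `(1 - T)⁻¹ p` of `η = p + T η`. -/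
def resolventApply (T : E →L[ℂ] E) (p : E) : E := Ring.inverse (1 - T) p

lemma eq_resolventApply_iff {T : E →L[ℂ] E} (h : ‖T‖ < 1) (p η : E) :
    η = resolventApply T p ↔ η = p + T η := by
  have hu : IsUnit (1 - T) := isUnit_one_sub_of_norm_lt_one h
  have h1 : Ring.inverse (1 - T) * (1 - T) = 1 := Ring.inverse_mul_cancel _ hu
  have h2 : (1 - T) * Ring.inverse (1 - T) = 1 := Ring.mul_inverse_cancel _ hu
  constructor
  · rintro rfl
    exact sub_eq_iff_eq_add.1 (congrArg (fun A : E →L[ℂ] E => A p) h2)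
  · intro h3
    have h4 : Ring.inverse (1 - T) (η - T η) = η := congrArg (fun A : E →L[ℂ] E => A η) h1
    rw [sub_eq_iff_eq_add.2 h3] at h4
    exact h4.symm

lemma differentiableAt_resolventApply {A B : E →L[ℂ] E} {z : ℂ} (h : ‖z • A + B‖ < 1) (p : E) :
    DifferentiableAt ℂ (fun z : ℂ => resolventApply (z • A + B) p) z := by
  have hM : DifferentiableAt ℂ (fun z : ℂ => 1 - (z • A + B)) z := by fun_prop
  have hu : IsUnit (1 - (z • A + B)) := isUnit_one_sub_of_norm_lt_one h
  have h2 : DifferentiableAt ℂ (fun z : ℂ => Ring.inverse (1 - (z • A + B))) z :=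
    DifferentiableAt.comp z (g := Ring.inverse) (differentiableAt_inverse hu) hM
  exact h2.clm_apply (differentiableAt_const _)

end Resolvent

/-! ### The Cauchy problem as a weighted integral equation. -/

section Cauchy

variable {q : ℝ → ℝ} {l : ℝ}

/-- Integration against the constant weight. -/
abbrev intOp (hl : 0 ≤ l) {κ : ℝ} (hκ : 0 < κ) : C(Icc (0 : ℝ) l, ℂ) →L[ℂ] C(Icc (0 : ℝ) l, ℂ) :=
  volterra hl hκ.le (intervalIntegrable_const (c := (1 : ℂ)))

lemma intervalIntegrable_coeff (hq : IntervalIntegrable q volume 0 l) :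
    IntervalIntegrable (fun t => I * (q t : ℂ)) volume 0 l :=
  IntervalIntegrable.const_mul ⟨hq.1.ofReal, hq.2.ofReal⟩ I

/-- Integration against the coefficient `-i (z - q)`. -/
def coeffOp (hl : 0 ≤ l) {κ : ℝ} (hκ : 0 < κ) (hq : IntervalIntegrable q volume 0 l) (z : ℂ) :
    C(Icc (0 : ℝ) l, ℂ) →L[ℂ] C(Icc (0 : ℝ) l, ℂ) :=
  z • volterra hl hκ.le (intervalIntegrable_const (c := -I)) +
    volterra hl hκ.le (intervalIntegrable_coeff hq)

lemma coeffOp_apply (hl : 0 ≤ l) {κ : ℝ} (hκ : 0 < κ) (hq : IntervalIntegrable q volume 0 l)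
    (z : ℂ) (f : C(Icc (0 : ℝ) l, ℂ)) (x : Icc (0 : ℝ) l) :
    coeffOp hl hκ hq z f x = (Real.exp (-(κ * x)) : ℂ) *
      ∫ t in (0 : ℝ)..x, -I * ((z - q t) * ((Real.exp (κ * t) : ℂ) * IccExtend hl f t)) := by
  simp only [coeffOp, _root_.add_apply, _root_.smul_apply,
    ContinuousMap.add_apply, ContinuousMap.smul_apply, volterra_apply, smul_eq_mul]
  rw [mul_left_comm, ← mul_add, ← intervalIntegral.integral_const_mul,
    ← intervalIntegral.integral_add
      ((intervalIntegrable_of_mem_Icc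
        (volterra_integrable hl κ intervalIntegrable_const f) x.2).const_mul z)
      (intervalIntegrable_of_mem_Icc
        (volterra_integrable hl κ (intervalIntegrable_coeff hq) f) x.2)]
  congr 1
  refine intervalIntegral.integral_congr fun t _ => ?_
  ring

/-- The integral operator of the Cauchy problem. -/
def cauchyOp (hl : 0 ≤ l) {κ : ℝ} (hκ : 0 < κ) (hq : IntervalIntegrable q volume 0 l) (z : ℂ) :
    C(Icc (0 : ℝ) l, ℂ) →L[ℂ] C(Icc (0 : ℝ) l, ℂ) :=
  intOp hl hκ ∘L intOp hl hκ ∘L coeffOp hl hκ hq z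

/-- The two plain integrations gain `1 / κ` each. The third, against the merely integrable `z - q`,
is charged its `L¹` norm. Taking `κ` of order `√|z|` therefore makes the operator contractive. -/
lemma norm_cauchyOp_le (hl : 0 ≤ l) {κ : ℝ} (hκ : 0 < κ) (hq : IntervalIntegrable q volume 0 l)
    (z : ℂ) :
    ‖cauchyOp hl hκ hq z‖ ≤ κ⁻¹ * (κ⁻¹ * (‖z‖ * l + ∫ t in (0 : ℝ)..l, ‖q t‖)) := by
  have h1 := norm_volterra_one_le hl hκ
  have h2 : ‖coeffOp hl hκ hq z‖ ≤ ‖z‖ * l + ∫ t in (0 : ℝ)..l, ‖q t‖ := by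
    rw [coeffOp]
    refine (ContinuousLinearMap.opNorm_add_le _ _).trans (add_le_add ?_ ?_)
    · refine (ContinuousLinearMap.opNorm_smul_le _ _).trans ?_
      gcongr
      refine (norm_volterra_le hl hκ.le _).trans_eq ?_
      simp
    · refine (norm_volterra_le hl hκ.le _).trans_eq ?_
      simp
  refine (ContinuousLinearMap.opNorm_comp_le _ _).trans ?_
  refine mul_le_mul h1 ((ContinuousLinearMap.opNorm_comp_le _ _).trans ?_) (norm_nonneg _)
    (by positivity)
  exact mul_le_mul h1 h2 (norm_nonneg _) (by positivity)

/-- The weight `exp (-κ x)`. -/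
def weight (l κ : ℝ) : C(Icc (0 : ℝ) l, ℂ) where
  toFun x := (Real.exp (-(κ * x)) : ℂ)
  continuous_toFun := by fun_prop

lemma norm_weight_le {κ : ℝ} (hκ : 0 ≤ κ) : ‖weight l κ‖ ≤ 1 := by
  refine (ContinuousMap.norm_le _ zero_le_one).2 fun x => ?_
  change ‖(Real.exp (-(κ * x)) : ℂ)‖ ≤ 1
  rw [norm_real, Real.norm_eq_abs, Real.abs_exp, Real.exp_le_one_iff]
  have := mul_nonneg hκ x.2.1
  linarith

/-- The inhomogeneity of the integral equation with initial data `c`. -/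
def initFun (hl : 0 ≤ l) {κ : ℝ} (hκ : 0 < κ) (c : Fin 3 → ℂ) : C(Icc (0 : ℝ) l, ℂ) :=
  c 0 • weight l κ + intOp hl hκ (c 1 • weight l κ + intOp hl hκ (c 2 • weight l κ))

lemma norm_initFun_le (hl : 0 ≤ l) {κ : ℝ} (hκ : 1 ≤ κ) (c : Fin 3 → ℂ) :
    ‖initFun hl (zero_lt_one.trans_le hκ) c‖ ≤ ‖c 0‖ + ‖c 1‖ + ‖c 2‖ := by
  have hκ0 : 0 < κ := zero_lt_one.trans_le hκ
  have hJ : ∀ f : C(Icc (0 : ℝ) l, ℂ), ‖intOp hl hκ0 f‖ ≤ ‖f‖ := fun f => by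
    refine (ContinuousLinearMap.le_opNorm _ f).trans ?_
    refine mul_le_of_le_one_left (norm_nonneg _) ((norm_volterra_one_le hl hκ0).trans ?_)
    exact inv_le_one_of_one_le₀ hκ
  have hc : ∀ a : ℂ, ‖a • weight l κ‖ ≤ ‖a‖ := fun a => by
    rw [norm_smul]
    exact mul_le_of_le_one_right (norm_nonneg _) (norm_weight_le hκ0.le)
  refine (norm_add_le _ _).trans ?_
  have h1 := (hJ (c 1 • weight l κ + intOp hl hκ0 (c 2 • weight l κ))).trans (norm_add_le _ _)
  have h2 := hJ (c 2 • weight l κ)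
  have h3 := hc (c 0)
  have h4 := hc (c 1)
  have h5 := hc (c 2)
  linarith

/-- The weighted first component of a solution. -/
def weighted (κ : ℝ) {y : ℝ → ℂ} (hy : ContinuousOn y (Icc 0 l)) : C(Icc (0 : ℝ) l, ℂ) where
  toFun x := (Real.exp (-(κ * x)) : ℂ) * y x
  continuous_toFun :=
    Continuous.mul (by fun_prop) (continuousOn_iff_continuous_domRestrict.1 hy)

lemma exp_mul_weighted (hl : 0 ≤ l) (κ : ℝ) {y : ℝ → ℂ} (hy : ContinuousOn y (Icc 0 l)) {t : ℝ}
    (ht : t ∈ Icc 0 l) : (Real.exp (κ * t) : ℂ) * IccExtend hl (weighted κ hy) t = y t := by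
  rw [IccExtend_of_mem hl _ ht]
  change (Real.exp (κ * t) : ℂ) * ((Real.exp (-(κ * t)) : ℂ) * y t) = y t
  rw [← mul_assoc, ← ofReal_mul, ← Real.exp_add]
  simp

lemma intOp_weighted (hl : 0 ≤ l) {κ : ℝ} (hκ : 0 < κ) {y : ℝ → ℂ}
    (hy : ContinuousOn y (Icc 0 l)) (x : Icc (0 : ℝ) l) :
    intOp hl hκ (weighted κ hy) x = (Real.exp (-(κ * x)) : ℂ) * ∫ t in (0 : ℝ)..x, y t := by
  rw [volterra_apply]
  congr 1
  refine intervalIntegral.integral_congr fun t ht => ?_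
  rw [uIcc_of_le x.2.1] at ht
  simp only [one_mul]
  exact exp_mul_weighted hl κ hy ⟨ht.1, ht.2.trans x.2.2⟩

lemma coeffOp_weighted (hl : 0 ≤ l) {κ : ℝ} (hκ : 0 < κ) (hq : IntervalIntegrable q volume 0 l)
    (z : ℂ) {y : ℝ → ℂ} (hy : ContinuousOn y (Icc 0 l)) (x : Icc (0 : ℝ) l) :
    coeffOp hl hκ hq z (weighted κ hy) x =
      (Real.exp (-(κ * x)) : ℂ) * ∫ t in (0 : ℝ)..x, -I * ((z - q t) * y t) := by
  rw [coeffOp_apply]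
  congr 1
  refine intervalIntegral.integral_congr fun t ht => ?_
  rw [uIcc_of_le x.2.1] at ht
  rw [exp_mul_weighted hl κ hy ⟨ht.1, ht.2.trans x.2.2⟩]

/-- A solution of the Cauchy problem solves the weighted integral equation. -/
lemma IsCauchySolution.integral_equation (hl : 0 < l) (hq : IntervalIntegrable q volume 0 l)
    {κ : ℝ} (hκ : 0 < κ) {lam : ℂ} {c : Fin 3 → ℂ} {Y : Fin 3 → ℝ → ℂ}
    (hY : IsCauchySolution q l lam c Y) :
    weighted κ hY.continuousOn_zero = initFun hl.le hκ c +
      cauchyOp hl.le hκ hq (lam ^ 3) (weighted κ hY.continuousOn_zero) := by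
  have h2 : weighted κ (hY.continuousOn_two hl hq) = c 2 • weight l κ +
      coeffOp hl.le hκ hq (lam ^ 3) (weighted κ hY.continuousOn_zero) := by
    ext x
    rw [ContinuousMap.add_apply, coeffOp_weighted, ContinuousMap.smul_apply, smul_eq_mul]
    change (Real.exp (-(κ * x)) : ℂ) * Y 2 x = c 2 * (Real.exp (-(κ * x)) : ℂ) + _
    rw [(hY.primitive_two hl hq).eq x x.2, hY.init hl]
    ring
  have h1 : weighted κ hY.continuousOn_one = c 1 • weight l κ +
      intOp hl.le hκ (weighted κ (hY.continuousOn_two hl hq)) := by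
    ext x
    rw [ContinuousMap.add_apply, intOp_weighted, ContinuousMap.smul_apply, smul_eq_mul]
    change (Real.exp (-(κ * x)) : ℂ) * Y 1 x = c 1 * (Real.exp (-(κ * x)) : ℂ) + _
    rw [(hY.primitive_one hl hq).eq x x.2, hY.init hl]
    ring
  have h0 : weighted κ hY.continuousOn_zero = c 0 • weight l κ +
      intOp hl.le hκ (weighted κ hY.continuousOn_one) := by
    ext x
    rw [ContinuousMap.add_apply, intOp_weighted, ContinuousMap.smul_apply, smul_eq_mul]
    change (Real.exp (-(κ * x)) : ℂ) * Y 0 x = c 0 * (Real.exp (-(κ * x)) : ℂ) + _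
    rw [(hY.primitive_zero hl).eq x x.2, hY.init hl]
    ring
  conv_lhs => rw [h0, h1, h2]
  simp only [initFun, cauchyOp, ContinuousLinearMap.comp_apply, map_add]
  abel

/-- A solution of the weighted integral equation yields a solution of the Cauchy problem. -/
lemma exists_isCauchySolution_of_integral_equation (hl : 0 < l)
    (hq : IntervalIntegrable q volume 0 l) {κ : ℝ} (hκ : 0 < κ) {lam : ℂ} {c : Fin 3 → ℂ}
    {η : C(Icc (0 : ℝ) l, ℂ)}
    (hη : η = initFun hl.le hκ c + cauchyOp hl.le hκ hq (lam ^ 3) η) :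
    ∃ Y, IsCauchySolution q l lam c Y := by
  set e : C(Icc (0 : ℝ) l, ℂ) → ℝ → ℂ := fun f t => (Real.exp (κ * t) : ℂ) * IccExtend hl.le f t
    with he
  have hec : ∀ f, Continuous (e f) := fun f =>
    Continuous.mul (by fun_prop) f.continuous.Icc_extend'
  have hcancel : ∀ (x : ℝ) (a : ℂ),
      (Real.exp (κ * x) : ℂ) * ((Real.exp (-(κ * x)) : ℂ) * a) = a := fun x a => by
    rw [← mul_assoc, ← ofReal_mul, ← Real.exp_add]
    simp
  set η2 := c 2 • weight l κ + coeffOp hl.le hκ hq (lam ^ 3) η with hη2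
  set η1 := c 1 • weight l κ + intOp hl.le hκ η2 with hη1
  have hη0 : η = c 0 • weight l κ + intOp hl.le hκ η1 := by
    rw [hη1, hη2]
    conv_lhs => rw [hη]
    simp only [initFun, cauchyOp, ContinuousLinearMap.comp_apply, map_add]
    abel
  have hint : ∀ (a : ℂ) (f g : C(Icc (0 : ℝ) l, ℂ)), g = a • weight l κ + intOp hl.le hκ f →
      ∀ x ∈ Icc 0 l, e g x = a + ∫ t in (0 : ℝ)..x, e f t := by
    rintro a f g rfl x hx
    simp only [he]
    rw [IccExtend_of_mem hl.le _ hx, ContinuousMap.add_apply, volterra_apply,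
      ContinuousMap.smul_apply, smul_eq_mul, mul_add, hcancel]
    simp only [one_mul]
    congr 1
    rw [mul_left_comm]
    change a * ((Real.exp (κ * x) : ℂ) * (Real.exp (-(κ * x)) : ℂ)) = a
    have := hcancel x 1
    rw [mul_one] at this
    rw [this, mul_one]
  have hint2 : ∀ x ∈ Icc 0 l, e η2 x = c 2 +
      ∫ t in (0 : ℝ)..x, -I * ((lam ^ 3 - (q t : ℂ)) * e η t) := by
    intro x hx
    simp only [he]
    rw [IccExtend_of_mem hl.le _ hx, hη2, ContinuousMap.add_apply, coeffOp_apply,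
      ContinuousMap.smul_apply, smul_eq_mul, mul_add, hcancel]
    congr 1
    rw [mul_left_comm]
    change c 2 * ((Real.exp (κ * x) : ℂ) * (Real.exp (-(κ * x)) : ℂ)) = c 2
    have := hcancel x 1
    rw [mul_one] at this
    rw [this, mul_one]
  have h0mem : (0 : ℝ) ∈ Icc 0 l := ⟨le_rfl, hl.le⟩
  have i0 : e η 0 = c 0 := by simpa using hint _ _ _ hη0 0 h0mem
  have i1 : e η1 0 = c 1 := by simpa using hint _ _ _ hη1 0 h0mem
  have i2 : e η2 0 = c 2 := by simpa using hint2 0 h0mem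
  refine ⟨![e η, e η1, e η2], IsCauchySolution.of_primitive ⟨hl.le, ?_, ?_⟩ ⟨hl.le, ?_, ?_⟩
    ⟨hl.le, ?_, ?_⟩ fun j => ?_⟩
  · exact (hec _).intervalIntegrable _ _
  · intro x hx
    simpa [i0] using hint _ _ _ hη0 x hx
  · exact (hec _).intervalIntegrable _ _
  · intro x hx
    simpa [i1] using hint _ _ _ hη1 x hx
  · exact (IsCauchySolution.intervalIntegrable_coeff_mul hl hq _ (hec _).continuousOn).const_mul _
  · intro x hx
    simpa [i2] using hint2 x hx
  · fin_cases j
    · exact i0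
    · exact i1
    · exact i2

/-- The solution of the integral equation. -/
def cauchySol (hl : 0 ≤ l) {κ : ℝ} (hκ : 0 < κ) (hq : IntervalIntegrable q volume 0 l)
    (c : Fin 3 → ℂ) (z : ℂ) : C(Icc (0 : ℝ) l, ℂ) :=
  resolventApply (cauchyOp hl hκ hq z) (initFun hl hκ c)

lemma eq_cauchySol_iff {hl : 0 ≤ l} {κ : ℝ} {hκ : 0 < κ}
    {hq : IntervalIntegrable q volume 0 l} {z : ℂ} (h : ‖cauchyOp hl hκ hq z‖ < 1)
    (c : Fin 3 → ℂ) (η : C(Icc (0 : ℝ) l, ℂ)) :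
    η = cauchySol hl hκ hq c z ↔ η = initFun hl hκ c + cauchyOp hl hκ hq z η :=
  eq_resolventApply_iff h _ _

lemma differentiableAt_cauchySol {hl : 0 ≤ l} {κ : ℝ} {hκ : 0 < κ}
    {hq : IntervalIntegrable q volume 0 l} {z : ℂ} (h : ‖cauchyOp hl hκ hq z‖ < 1)
    (c : Fin 3 → ℂ) : DifferentiableAt ℂ (cauchySol hl hκ hq c) z := by
  set A := intOp hl hκ ∘L intOp hl hκ ∘L volterra hl hκ.le (intervalIntegrable_const (c := -I))
  set B := intOp hl hκ ∘L intOp hl hκ ∘L volterra hl hκ.le (intervalIntegrable_coeff hq)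
  have h1 : ∀ w, cauchyOp hl hκ hq w = w • A + B := by
    intro w
    ext1 f
    simp [cauchyOp, coeffOp, A, B]
  have h2 : cauchySol hl hκ hq c = fun w => resolventApply (w • A + B) (initFun hl hκ c) := by
    funext w
    rw [cauchySol, h1]
  rw [h2]
  exact differentiableAt_resolventApply (by rwa [← h1]) _

/-- Existence, uniqueness, growth and analytic dependence on the spectral parameter. -/
theorem exists_entire_solution (hl : 0 < l) (hq : IntervalIntegrable q volume 0 l)
    (c : Fin 3 → ℂ) :
    ∃ G : ℂ → C(Icc (0 : ℝ) l, ℂ), Differentiable ℂ G ∧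
      (∃ D B : ℝ, 0 ≤ D ∧ 0 ≤ B ∧ ∀ z, ‖G z‖ ≤ Real.exp (D + B * √‖z‖)) ∧
      ∀ lam : ℂ, (∃ Y, IsCauchySolution q l lam c Y) ∧
        ∀ Y, IsCauchySolution q l lam c Y → ∀ x : Icc (0 : ℝ) l, Y 0 x = G (lam ^ 3) x := by
  set Q := ∫ t in (0 : ℝ)..l, ‖q t‖ with hQ
  have hQ0 : 0 ≤ Q := intervalIntegral.integral_nonneg hl.le fun _ _ => norm_nonneg _
  -- Chosen so that the operator norm is at most `1/2` for `‖z‖ ≤ r`. The `+ 1` ensures `k ≥ 1`, and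
  -- `|r|` below makes the weight positive for every real `r`.
  set k : ℝ → ℝ := fun r => √(2 * (r * l + Q) + 1) with hk
  have hk1 : ∀ r, 0 ≤ r → 1 ≤ k r := fun r hr => by
    rw [hk, Real.one_le_sqrt]
    have : 0 ≤ r * l := by positivity
    linarith
  have hkpos : ∀ r, 0 < k |r| := fun r => zero_lt_one.trans_le (hk1 _ (abs_nonneg r))
  have hnorm : ∀ r z, ‖z‖ ≤ |r| → ‖cauchyOp hl.le (hkpos r) hq z‖ ≤ 1 / 2 := by
    intro r z hz
    refine (norm_cauchyOp_le hl.le (hkpos r) hq z).trans ?_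
    have hsq : k |r| ^ 2 = 2 * (|r| * l + Q) + 1 := Real.sq_sqrt (by positivity)
    have hle : ‖z‖ * l ≤ |r| * l := by gcongr
    rw [← mul_assoc, ← mul_inv, ← sq, hsq, inv_mul_eq_div, div_le_iff₀ (by positivity)]
    linarith
  have hlt : ∀ r z, ‖z‖ ≤ |r| → ‖cauchyOp hl.le (hkpos r) hq z‖ < 1 := fun r z hz =>
    (hnorm r z hz).trans_lt (by norm_num)
  set ex : ℝ → C(Icc (0 : ℝ) l, ℂ) := fun r =>
    ⟨fun x => (Real.exp (k |r| * x) : ℂ), by fun_prop⟩ with hex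
  set G : ℝ → ℂ → C(Icc (0 : ℝ) l, ℂ) := fun r z =>
    ex r * cauchySol hl.le (hkpos r) hq c z with hG
  have hexists : ∀ lam : ℂ, ∃ Y, IsCauchySolution q l lam c Y := fun lam =>
    exists_isCauchySolution_of_integral_equation hl hq (hkpos ‖lam ^ 3‖)
      ((eq_cauchySol_iff (hlt _ (lam ^ 3) (le_abs_self _)) c _).1 rfl)
  have hrep : ∀ r lam, ‖lam ^ 3‖ ≤ |r| → ∀ Y, IsCauchySolution q l lam c Y →
      ∀ x : Icc (0 : ℝ) l, Y 0 x = G r (lam ^ 3) x := by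
    intro r lam hlam Y hY x
    have h1 := (eq_cauchySol_iff (hlt r _ hlam) c _).2
      (hY.integral_equation hl hq (hkpos r))
    have h2 := exp_mul_weighted hl.le (k |r|) hY.continuousOn_zero x.2
    rw [IccExtend_of_mem hl.le _ x.2] at h2
    simp only [hG, ContinuousMap.mul_apply, ← h1]
    exact h2.symm
  have hcube : ∀ z : ℂ, ∃ lam : ℂ, lam ^ 3 = z := fun z =>
    IsAlgClosed.exists_pow_nat_eq z (by norm_num)
  -- Both sides represent the same Cauchy solution, so the weight may be frozen near a point to get
  -- differentiability and adapted to `‖z‖` for growth.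
  have hagree : ∀ r r' z, ‖z‖ ≤ |r| → ‖z‖ ≤ |r'| → G r z = G r' z := by
    intro r r' z h1 h2
    obtain ⟨lam, rfl⟩ := hcube z
    obtain ⟨Y, hY⟩ := hexists lam
    ext x
    rw [← hrep r lam h1 Y hY x, ← hrep r' lam h2 Y hY x]
  have hGd : ∀ r z, ‖z‖ ≤ |r| → DifferentiableAt ℂ (G r) z := fun r z hz =>
    (differentiableAt_const _).mul (differentiableAt_cauchySol (hlt r z hz) c)
  refine ⟨fun z => G ‖z‖ z, fun z => ?_, ?_, fun lam =>
    ⟨hexists lam, hrep _ lam (le_abs_self _)⟩⟩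
  · refine (hGd (‖z‖ + 1) z ((lt_add_one _).le.trans (le_abs_self _))).congr_of_eventuallyEq ?_
    filter_upwards [Metric.ball_mem_nhds z zero_lt_one] with w hw
    refine hagree _ _ _ (le_abs_self _) (le_trans ?_ (le_abs_self _))
    have h1 := norm_sub_norm_le w z
    rw [Metric.mem_ball, dist_eq_norm] at hw
    linarith
  · set m := ‖c 0‖ + ‖c 1‖ + ‖c 2‖ with hm
    have hm0 : 0 ≤ m := by positivity
    -- The weighted solution is bounded by `2 m ≤ exp (2 m)`; removing the weight costs `exp (κ l)`
    -- with `κ ≤ √(2 Q + 1) + √(2 l) √‖z‖`.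
    refine ⟨2 * m + l * √(2 * Q + 1), l * √(2 * l), by positivity, by positivity, fun z => ?_⟩
    set η := cauchySol hl.le (hkpos ‖z‖) hq c z with hη
    have h1 := (eq_cauchySol_iff (hlt ‖z‖ z (le_abs_self _)) c η).1 rfl
    have h2 : ‖η‖ ≤ 2 * m := by
      have h3 := ContinuousLinearMap.le_of_opNorm_le _ (hnorm ‖z‖ z (le_abs_self _)) η
      have h4 := norm_initFun_le hl.le (hk1 _ (abs_nonneg ‖z‖)) c
      have h5 : ‖η‖ ≤ _ := (congrArg norm h1).le.trans (norm_add_le _ _)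
      linarith
    have h3 : ‖ex ‖z‖‖ ≤ Real.exp (l * √(2 * Q + 1) + l * √(2 * l) * √‖z‖) := by
      refine (ContinuousMap.norm_le _ (by positivity)).2 fun x => ?_
      change ‖(Real.exp (k |‖z‖| * x) : ℂ)‖ ≤ _
      rw [norm_real, Real.norm_eq_abs, Real.abs_exp, Real.exp_le_exp, abs_norm]
      have h4 : k ‖z‖ ≤ √(2 * Q + 1) + √(2 * l) * √‖z‖ := by
        refine Real.sqrt_le_iff.2 ⟨by positivity, ?_⟩
        have h5 := Real.sq_sqrt (by positivity : 0 ≤ 2 * Q + 1)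
        have h6 := Real.sq_sqrt (by positivity : 0 ≤ 2 * l)
        have h7 := Real.sq_sqrt (norm_nonneg z)
        have h8 : 0 ≤ √(2 * Q + 1) * (√(2 * l) * √‖z‖) := by positivity
        rw [add_sq, mul_pow, h5, h6, h7]
        linarith
      have h5 : 0 ≤ k ‖z‖ := Real.sqrt_nonneg _
      calc k ‖z‖ * x ≤ k ‖z‖ * l := by gcongr; exact x.2.2
        _ ≤ (√(2 * Q + 1) + √(2 * l) * √‖z‖) * l := by gcongr
        _ = _ := by ring
    calc ‖ex ‖z‖ * η‖ ≤ ‖ex ‖z‖‖ * ‖η‖ := norm_mul_le _ _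
      _ ≤ Real.exp (l * √(2 * Q + 1) + l * √(2 * l) * √‖z‖) * Real.exp (2 * m) := by
        gcongr
        linarith [Real.add_one_le_exp (2 * m)]
      _ = _ := by
        rw [← Real.exp_add]
        congr 1
        ring

end Cauchy

end ThirdOrder

end

noncomputable section

namespace ThirdOrder

open Filter Topology ComplexConjugate

/-! ### The characteristic functions -/

/-- `U` is an entire function of Hermite–Biehler type with reproducing kernel `K`. -/
structure IsHermiteBiehler (U : ℂ → ℂ) (K : ℂ → ℂ → ℂ) : Prop where
  differentiable : Differentiable ℂ U
  ne_zero : ∀ z, 0 ≤ z.im → U z ≠ 0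
  continuous_kernel : ∀ w, Continuous fun z => K z w
  kernel_ne_zero : ∀ z, U z ≠ 0 → K z z ≠ 0
  identity : ∀ z w, U z * conj (U w) - conj (U (conj z)) * U (conj w) =
    -I * (z - conj w) * K z w

/-! ### Zeros of `U^# + θ U`. -/

namespace IsHermiteBiehler

variable {U : ℂ → ℂ} {K : ℂ → ℂ → ℂ} {θ z : ℂ}

lemma differentiable_conj_add (hU : IsHermiteBiehler U K) (θ : ℂ) :
    Differentiable ℂ fun z => -(conj (U (conj z)) + θ * U z) := by
  intro z
  have h1 : DifferentiableAt ℂ (conj ∘ U ∘ conj) (conj (conj z)) :=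
    (hU.differentiable (conj z)).conj_conj
  rw [conj_conj] at h1
  exact (h1.add ((hU.differentiable z).const_mul θ)).neg

/-- If `U z` vanished, so would `U (conj z)`, but one of the two points lies in the closed upper
half-plane. -/
lemma ne_zero_of_eq_zero (hU : IsHermiteBiehler U K) (hz : conj (U (conj z)) + θ * U z = 0) :
    U z ≠ 0 := by
  intro h0
  rw [h0, mul_zero, add_zero, map_eq_zero] at hz
  rcases le_total 0 z.im with h | h
  · exact hU.ne_zero z h h0
  · exact hU.ne_zero (conj z) (by simpa using h) hz

/-- At such a zero `|U(conj z)| = |U(z)|`, so the diagonal identity reads `Im z · K(z, z) = 0`. -/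
lemma im_eq_zero (hU : IsHermiteBiehler U K) (hθ : ‖θ‖ = 1)
    (hz : conj (U (conj z)) + θ * U z = 0) : z.im = 0 := by
  have hK := hU.kernel_ne_zero z (hU.ne_zero_of_eq_zero hz)
  have h1 := hU.identity z z
  have h2 : conj (U (conj z)) = -(θ * U z) := eq_neg_of_add_eq_zero_left hz
  have h3 : U (conj z) = -(conj θ * conj (U z)) := by
    have := congrArg conj h2
    simpa using this
  have hθ' : θ * conj θ = 1 := by
    rw [mul_conj, normSq_eq_norm_sq, hθ]
    simp
  rw [h2, h3, sub_conj] at h1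
  have h4 : -I * (((2 * z.im : ℝ) : ℂ) * I) * K z z = 0 := by
    rw [← h1]
    linear_combination (-(U z * conj (U z))) * hθ'
  have h5 := (mul_eq_zero.1 h4).resolve_right hK
  simpa using h5

lemma deriv_ne_zero (hU : IsHermiteBiehler U K) (hθ : ‖θ‖ = 1)
    (hz : conj (U (conj z)) + θ * U z = 0) :
    deriv (fun w => -(conj (U (conj w)) + θ * U w)) z ≠ 0 := by
  have hzr : conj z = z := conj_eq_iff_im.2 (hU.im_eq_zero hθ hz)
  have hUz := hU.ne_zero_of_eq_zero hz
  have hθ' : θ * conj θ = 1 := by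
    rw [mul_conj, normSq_eq_norm_sq, hθ]
    simp
  set F : ℂ → ℂ := fun w => -(conj (U (conj w)) + θ * U w) with hF
  have hUzc : U z = -(conj θ * conj (U z)) := by
    have h2 : conj (U (conj z)) = -(θ * U z) := eq_neg_of_add_eq_zero_left hz
    rw [hzr] at h2
    simpa using congrArg conj h2
  have hFd : DifferentiableAt ℂ F z := hU.differentiable_conj_add θ z
  have hFz : F z = 0 := by simp only [hF, hz, neg_zero]
  -- With `z` a real zero, the kernel identity becomes a factorization of `F` by `w - z`. A
  -- vanishing derivative would force `K z z = 0`.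
  have hid : ∀ w, -(conj (U z) * conj θ) * F w = -I * (w - z) * K w z := by
    intro w
    have h1 := hU.identity w z
    rw [hzr] at h1
    rw [← h1]
    simp only [hF]
    linear_combination (U w * conj (U z)) * hθ' + conj (U (conj w)) * hUzc
  intro hder
  have h1 : Tendsto (fun w => -I * K w z) (𝓝[≠] z) (𝓝 (-(conj (U z) * conj θ) * 0)) := by
    have h2 := hFd.hasDerivAt
    rw [hder, hasDerivAt_iff_tendsto_slope] at h2
    refine (h2.const_mul (-(conj (U z) * conj θ))).congr' ?_
    filter_upwards [self_mem_nhdsWithin] with w hw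
    have hw' : w - z ≠ 0 := sub_ne_zero.2 hw
    rw [slope_def_field, hFz, sub_zero, ← mul_div_assoc, hid]
    field_simp
  have h2 : Tendsto (fun w => -I * K w z) (𝓝[≠] z) (𝓝 (-I * K z z)) :=
    (((hU.continuous_kernel z).tendsto z).const_mul _).mono_left nhdsWithin_le_nhds
  have h3 := tendsto_nhds_unique h1 h2
  rw [mul_zero, eq_comm, mul_eq_zero] at h3
  exact h3.elim (by simp) (hU.kernel_ne_zero z hUz)

end IsHermiteBiehler

/-! ### Characteristic functions in terms of `U`, and their products. -/

section CharFun

variable {q : ℝ → ℝ} {l : ℝ}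

lemma fundSol_spec (hl : 0 < l) (hq : IntervalIntegrable q volume 0 l) (p : Fin 3) (lam : ℂ) :
    IsCauchySolution q l lam (Pi.single p 1) (fundSol q l p lam) := by
  obtain ⟨_, _, _, h⟩ := exists_entire_solution hl hq (Pi.single p 1)
  exact Classical.epsilon_spec (h lam).1

/-- The solution `s₂ + i h s₀`. -/
def bdrySol (q : ℝ → ℝ) (l h : ℝ) (lam : ℂ) : Fin 3 → ℝ → ℂ := fun j x =>
  1 * fundSol q l 2 lam j x + I * h * fundSol q l 0 lam j x

lemma bdrySol_spec (hl : 0 < l) (hq : IntervalIntegrable q volume 0 l) (h : ℝ) (lam : ℂ) :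
    IsCauchySolution q l lam ![I * h, 0, 1] (bdrySol q l h lam) := by
  have h1 := (fundSol_spec hl hq 2 lam).lin_comb hl hq (fundSol_spec hl hq 0 lam) 1 (I * h)
  convert h1 using 1
  · funext j
    fin_cases j <;> simp
  · rfl

lemma exists_pow_three_eq (z : ℂ) : ∃ lam : ℂ, lam ^ 3 = z :=
  IsAlgClosed.exists_pow_nat_eq z (by norm_num)

/-- The characteristic function is expressed by an entire function of Hermite–Biehler type and
order less than one. -/
theorem exists_isHermiteBiehler (hl : 0 < l) (hq : IntervalIntegrable q volume 0 l) (h : ℝ) :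
    ∃ U K, IsHermiteBiehler U K ∧
      (∃ D B : ℝ, 0 ≤ D ∧ 0 ≤ B ∧ ∀ z, ‖U z‖ ≤ Real.exp (D + B * √‖z‖)) ∧
      (∀ lam, s q l 2 lam + I * h * s q l 0 lam = U (lam ^ 3)) ∧
      ∀ θ lam, charFunH q l θ h lam =
        -(conj (U (conj (lam ^ 3))) + θ * U (lam ^ 3)) := by
  obtain ⟨Gu, hGu, ⟨D, B, hD, hB, hgr⟩, hu⟩ := exists_entire_solution hl hq ![I * h, 0, 1]
  obtain ⟨G1, hG1, -, h1⟩ := exists_entire_solution hl hq (Pi.single 1 1)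
  set L : Icc (0 : ℝ) l := ⟨l, hl.le, le_rfl⟩ with hL
  set U : ℂ → ℂ := fun z => Gu z L with hUdef
  set S : ℂ → ℂ := fun z => G1 z L with hSdef
  have heval : ∀ {G : ℂ → C(Icc (0 : ℝ) l, ℂ)}, Differentiable ℂ G →
      Differentiable ℂ fun z => G z L := fun {G} hG =>
    (ContinuousMap.evalCLM ℂ L : C(Icc (0 : ℝ) l, ℂ) →L[ℂ] ℂ).differentiable.comp hG
  have hUu : ∀ lam, bdrySol q l h lam 0 l = U (lam ^ 3) := fun lam =>
    (hu lam).2 _ (bdrySol_spec hl hq h lam) L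
  have hS1 : ∀ lam, fundSol q l 1 lam 0 l = S (lam ^ 3) := fun lam =>
    (h1 lam).2 _ (fundSol_spec hl hq 1 lam) L
  -- The conjugated minors of `s₁` and `u` have data `-(i h, 0, 1)`, so after a change of sign they
  -- are `u` at the conjugate parameter.
  have hwedge : ∀ lam, fundSol q l 1 lam 1 l * bdrySol q l h lam 0 l -
      fundSol q l 1 lam 0 l * bdrySol q l h lam 1 l = -conj (U (conj (lam ^ 3))) := by
    intro lam
    have hw := (fundSol_spec hl hq 1 lam).wedge hl hq (bdrySol_spec hl hq h lam)
    have hw' := hw.lin_comb hl hq hw (-1) 0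
    rw [show (fun j => _ : Fin 3 → ℂ) = ![I * (h : ℂ), 0, 1] by
      funext j
      fin_cases j <;> simp] at hw'
    have h2 := (hu (conj lam)).2 _ hw' L
    simp only [Matrix.cons_val, hL] at h2
    rw [← map_pow] at h2
    have h3 := congrArg conj h2
    simp only [zero_mul, add_zero, map_mul, map_neg, map_one, conj_conj] at h3
    change _ = conj (U (conj (lam ^ 3))) at h3
    rw [← h3]
    ring
  -- This combination vanishes at `l` and satisfies `y(0) = i h y''(0)`, `y'(0) = U`, `y'(l) =
  -- -U^#`.
  set y : ℂ → C(Icc (0 : ℝ) l, ℂ) := fun z => U z • G1 z - S z • Gu z with hy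
  have hyc : Continuous y :=
    (((heval hGu).continuous.smul hG1.continuous).sub
      ((heval hG1).continuous.smul hGu.continuous))
  set Y : ℂ → Fin 3 → ℝ → ℂ := fun lam j x =>
    U (lam ^ 3) * fundSol q l 1 lam j x + -S (lam ^ 3) * bdrySol q l h lam j x with hYdef
  have hY := fun lam => (fundSol_spec hl hq 1 lam).lin_comb hl hq (bdrySol_spec hl hq h lam)
    (U (lam ^ 3)) (-S (lam ^ 3))
  have hYy : ∀ lam, ∀ x : Icc (0 : ℝ) l, Y lam 0 x = y (lam ^ 3) x := by
    intro lam x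
    simp only [hYdef, hy, ContinuousMap.sub_apply, ContinuousMap.smul_apply, smul_eq_mul]
    rw [(hu lam).2 _ (bdrySol_spec hl hq h lam) x, (h1 lam).2 _ (fundSol_spec hl hq 1 lam) x]
    ring
  have hYe : ∀ lam, ∀ t ∈ Icc 0 l, Y lam 0 t = IccExtend hl.le (y (lam ^ 3)) t := by
    intro lam t ht
    rw [IccExtend_of_mem hl.le _ ht]
    exact hYy lam ⟨t, ht⟩
  set K : ℂ → ℂ → ℂ := fun z w =>
    ∫ t in (0 : ℝ)..l, IccExtend hl.le (y z) t * conj (IccExtend hl.le (y w) t) with hK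
  refine ⟨U, K, ⟨heval hGu, ?_, ?_, ?_, ?_⟩, ⟨D, B, hD, hB, fun z =>
    ((Gu z).norm_coe_le_norm L).trans (hgr z)⟩, fun lam => ?_, fun θ lam => ?_⟩
  · intro z hz
    obtain ⟨lam, rfl⟩ := exists_pow_three_eq z
    rw [← hUu]
    exact (bdrySol_spec hl hq h lam).ne_zero_of_im_nonneg hl hq hz (by simp) (by simp)
      (by simp)
  · intro w
    refine intervalIntegral.continuous_parametric_intervalIntegral_of_continuous' ?_ _ _
    have hc1 : Continuous fun p : ℂ × ℝ => (y p.1) (projIcc 0 l hl.le p.2) :=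
      (hyc.comp continuous_fst).eval (continuous_projIcc.comp continuous_snd)
    have hc2 : Continuous fun p : ℂ × ℝ => conj ((y w) (projIcc 0 l hl.le p.2)) :=
      continuous_conj.comp ((y w).continuous.comp (continuous_projIcc.comp continuous_snd))
    exact hc1.mul hc2
  · intro z hz hKz
    obtain ⟨lam, rfl⟩ := exists_pow_three_eq z
    set g : ℝ → ℝ := fun t => ‖IccExtend hl.le (y (lam ^ 3)) t‖ ^ 2 with hg
    have hgc : Continuous g := ((y (lam ^ 3)).continuous.Icc_extend'.norm).pow 2
    have h2 : ∫ t in (0 : ℝ)..l, g t = 0 := by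
      have h3 : K (lam ^ 3) (lam ^ 3) = ((∫ t in (0 : ℝ)..l, g t : ℝ) : ℂ) := by
        rw [← intervalIntegral.integral_ofReal]
        refine intervalIntegral.integral_congr fun t _ => ?_
        simp [hg, mul_conj, normSq_eq_norm_sq]
      rw [hKz] at h3
      exact_mod_cast h3.symm
    have h4 : ∀ x ∈ Icc 0 l, Y lam 0 x = 0 := by
      intro x hx
      by_contra hne
      have h5 : 0 < ∫ t in (0 : ℝ)..l, g t := by
        refine intervalIntegral.integral_pos hl hgc.continuousOn (fun t _ => by positivity)
          ⟨x, hx, ?_⟩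
        simp only [hg]
        rw [← hYe lam x hx]
        have := norm_pos_iff.2 hne
        positivity
      exact h5.ne' h2
    have h5 := ((hY lam).init_eq_zero_of_eqOn_zero hl h4).1
    exact hz (by simpa using h5)
  -- In the Lagrange form only `-y' conj y'` survives: at `l` because `y(l) = 0`, at `0` because the
  -- two terms with `h` cancel for real `h`.
  · intro z w
    obtain ⟨lam, rfl⟩ := exists_pow_three_eq z
    obtain ⟨mu, rfl⟩ := exists_pow_three_eq w
    have h2 := ((hY lam).lagrange hl hq (hY mu)).eq l ⟨hl.le, le_rfl⟩
    rw [intervalIntegral.integral_const_mul] at h2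
    have h3 : ∫ t in (0 : ℝ)..l, Y lam 0 t * conj (Y mu 0 t) = K (lam ^ 3) (mu ^ 3) := by
      refine intervalIntegral.integral_congr fun t ht => ?_
      rw [uIcc_of_le hl.le] at ht
      rw [hYe lam t ht, hYe mu t ht]
    simp only [hYdef] at h3
    rw [h3] at h2
    have hend : ∀ lam, U (lam ^ 3) * fundSol q l 1 lam 0 l +
        -S (lam ^ 3) * bdrySol q l h lam 0 l = 0 := by
      intro lam
      rw [hS1, hUu]
      ring
    have hend' : ∀ lam, U (lam ^ 3) * fundSol q l 1 lam 1 l +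
        -S (lam ^ 3) * bdrySol q l h lam 1 l = -conj (U (conj (lam ^ 3))) := by
      intro lam
      rw [← hwedge, hUu, hS1]
      ring
    rw [hend, hend, hend', hend'] at h2
    have i1 := fun lam => (fundSol_spec hl hq 1 lam).init hl
    have i2 := fun lam => (bdrySol_spec hl hq h lam).init hl
    simp only [i1, i2] at h2
    simp only [map_neg, conj_conj, map_zero, mul_zero, zero_mul, zero_sub, add_zero, map_add,
      map_mul, Pi.single_eq_same, Matrix.cons_val, ne_eq, Fin.reduceEq, not_false_eq_true,
      Pi.single_eq_of_ne, mul_one, zero_add, conj_I, conj_ofReal, neg_mul] at h2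
    linear_combination h2
  · rw [← hUu]
    simp [bdrySol, s]
  · have h2 := hwedge lam
    have h3 := hUu lam
    rw [← h3, neg_add, ← h2]
    simp only [charFunH, bdrySol, s, s', Matrix.det_fin_three, Matrix.of_apply, Matrix.cons_val]
    ring

lemma charFunH_zero_right (θ lam : ℂ) : charFunH q l θ 0 lam = charFun q l θ lam := by
  simp only [charFunH, charFun, Matrix.det_fin_three, Matrix.of_apply, Matrix.cons_val,
    ofReal_zero]
  ring

lemma mul_phase (z : ℂ) : z * phase z = conj z := by
  rcases eq_or_ne z 0 with rfl | hz
  · simp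
  · rw [phase]
    field_simp

lemma charFunH_at_zero (hl : 0 < l) (hq : IntervalIntegrable q volume 0 l) (θ : ℂ) (h : ℝ) :
    charFunH q l θ h 0 = -(s q l 2 0 * (θ + phase (s q l 2 0)) +
      I * h * s q l 0 0 * (θ - phase (s q l 0 0))) := by
  obtain ⟨U, K, -, -, hs, hchar⟩ := exists_isHermiteBiehler hl hq h
  have h1 := hs 0
  have h2 := hchar θ 0
  rw [zero_pow three_ne_zero] at h1 h2
  rw [map_zero] at h2
  rw [h2, ← h1]
  simp only [map_add, map_mul, conj_I, conj_ofReal]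
  linear_combination mul_phase (s q l 2 0) - I * h * mul_phase (s q l 0 0)

lemma exists_real_pow_three_eq (x : ℝ) : ∃ μ : ℝ, μ ^ 3 = x := by
  have h : ∀ x : ℝ, 0 ≤ x → (x ^ ((3 : ℕ) : ℝ)⁻¹) ^ 3 = x := fun x hx =>
    Real.rpow_inv_natCast_pow hx three_ne_zero
  rcases le_total 0 x with hx | hx
  · exact ⟨_, h x hx⟩
  · refine ⟨-((-x) ^ ((3 : ℕ) : ℝ)⁻¹), ?_⟩
    rw [Odd.neg_pow (by decide), h (-x) (by linarith), neg_neg]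

/-- The product formula for the characteristic functions. -/
theorem hasProd_charFunH (hl : 0 < l) (hq : IntervalIntegrable q volume 0 l) {θ : ℂ}
    (hθ : ‖θ‖ = 1) (h : ℝ) (h0 : charFunH q l θ h 0 ≠ 0) (lam : ℂ) :
    HasProd (fun μ : {μ : ℝ | charFunH q l θ h μ = 0} => factor lam μ)
      (charFunH q l θ h lam / charFunH q l θ h 0) := by
  obtain ⟨U, K, hU, ⟨D, B, hD, hB, hgr⟩, -, hchar⟩ := exists_isHermiteBiehler hl hq h
  replace hchar := hchar θ
  set F : ℂ → ℂ := fun z => -(conj (U (conj z)) + θ * U z) with hF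
  have hchar' : ∀ lam, charFunH q l θ h lam = F (lam ^ 3) := hchar
  have hF0 : F 0 ≠ 0 := by
    rw [hchar', zero_pow three_ne_zero] at h0
    exact h0
  have hFd : Differentiable ℂ F := hU.differentiable_conj_add θ
  have hFz : ∀ z, F z = 0 → conj (U (conj z)) + θ * U z = 0 := fun z hz => neg_eq_zero.1 hz
  have hFgr : ∀ z, ‖F z‖ ≤ Real.exp (D + 1 + B * √‖z‖) := by
    intro z
    have h1 := hgr (conj z)
    rw [RCLike.norm_conj] at h1
    have h2 := hgr z
    calc ‖F z‖ ≤ ‖conj (U (conj z))‖ + ‖θ * U z‖ := by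
          simp only [hF, norm_neg]
          exact norm_add_le _ _
      _ ≤ 2 * Real.exp (D + B * √‖z‖) := by
          rw [RCLike.norm_conj, norm_mul, hθ]
          linarith
      _ ≤ Real.exp 1 * Real.exp (D + B * √‖z‖) := by
          gcongr
          linarith [Real.add_one_le_exp 1]
      _ = _ := by
          rw [← Real.exp_add]
          congr 1
          ring
  -- Normalization at the origin divides by `F 0`; the factor `‖F 0‖⁻¹ ≤ exp ‖F 0‖⁻¹` goes into the
  -- constant `D`.
  have hprod := hasProd_zeros (f := fun z => F z / F 0) (D := D + 1 + ‖F 0‖⁻¹) (B := B)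
    (hFd.div_const _) (div_self hF0) hB (by positivity)
    (fun z => by
      rw [norm_div, div_eq_inv_mul]
      calc ‖F 0‖⁻¹ * ‖F z‖
          ≤ Real.exp ‖F 0‖⁻¹ * Real.exp (D + 1 + B * √‖z‖) := by
            gcongr
            · linarith [Real.add_one_le_exp ‖F 0‖⁻¹]
            · exact hFgr z
        _ = _ := by
            rw [← Real.exp_add]
            congr 1
            ring)
    (fun z hz => by
      rw [deriv_div_const]
      exact div_ne_zero (hU.deriv_ne_zero hθ
        (hFz z ((div_eq_zero_iff.1 hz).resolve_right hF0))) hF0)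
    (lam ^ 3)
  have hzero : ∀ μ : ℝ, charFunH q l θ h μ = 0 ↔ F ((μ : ℂ) ^ 3) / F 0 = 0 := fun μ => by
    rw [hchar', div_eq_zero_iff, or_iff_left hF0]
  -- Cubing matches the real `λ_n` with all complex zeros in `z`, as these are real and cubing is a
  -- bijection of the real line.
  set e : {μ : ℝ | charFunH q l θ h μ = 0} → {a : ℂ // F a / F 0 = 0} :=
    fun μ => ⟨(μ : ℂ) ^ 3, (hzero μ).1 μ.2⟩ with he
  have hbij : Function.Bijective e := by
    constructor
    · intro μ ν hμν
      have h1 : ((μ : ℝ) : ℂ) ^ 3 = ((ν : ℝ) : ℂ) ^ 3 := congrArg Subtype.val hμν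
      have h2 : (μ : ℝ) ^ 3 = (ν : ℝ) ^ 3 := by exact_mod_cast h1
      exact Subtype.ext ((Odd.strictMono_pow (by decide : Odd 3)).injective h2)
    · rintro ⟨a, ha⟩
      have him : a.im = 0 := hU.im_eq_zero hθ
        (hFz a ((div_eq_zero_iff.1 ha).resolve_right hF0))
      obtain ⟨μ, hμ⟩ := exists_real_pow_three_eq a.re
      have hμa : (μ : ℂ) ^ 3 = a := by
        rw [← ofReal_pow, hμ]
        exact Complex.ext (by simp) (by simp [him])
      exact ⟨⟨μ, (hzero μ).2 (by rw [hμa]; exact ha)⟩, Subtype.ext hμa⟩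
  have h1 := (Equiv.ofBijective e hbij).hasProd_iff.2 hprod
  rw [hchar', hchar' 0, zero_pow three_ne_zero]
  exact h1

end CharFun

/-! ### Reconstruction from the spectral sets. -/

section Recover

variable {q : ℝ → ℝ} {l : ℝ}

lemma spectralSetH_facts (hl : 0 < l) (hq : IntervalIntegrable q volume 0 l) {θ : ℂ}
    (hθ : ‖θ‖ = 1) {h : ℝ} (hA : (spectralSetH q l θ h).Admissible) (lam : ℂ) :
    Multipliable (fun μ : (spectralSetH q l θ h).zeros => factor lam μ) ∧
      (spectralSetH q l θ h).delta lam = charFunH q l θ h lam := by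
  have h1 := charFunH_at_zero hl hq θ h
  have h0 : charFunH q l θ h 0 ≠ 0 := by
    rw [h1]
    exact neg_ne_zero.2 hA.2.2
  have hp := hasProd_charFunH hl hq hθ h h0 lam
  refine ⟨hp.multipliable, ?_⟩
  have h2 : ∏' μ : (spectralSetH q l θ h).zeros, factor lam μ =
      charFunH q l θ h lam / charFunH q l θ h 0 := hp.tprod_eq
  rw [SpectralSetH.delta, h2]
  simp only [spectralSetH]
  rw [← h1]
  field_simp

lemma spectralSet_facts (hl : 0 < l) (hq : IntervalIntegrable q volume 0 l) {θ : ℂ}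
    (hθ : ‖θ‖ = 1) (ha : s q l 2 0 ≠ 0) (hp : θ + phase (s q l 2 0) ≠ 0) (lam : ℂ) :
    Multipliable (fun μ : (spectralSet q l θ).zeros => factor lam μ) ∧
      (spectralSet q l θ).delta lam = charFun q l θ lam := by
  have hA : (spectralSetH q l θ 0).Admissible :=
    ⟨ha, hp, by simpa [spectralSetH] using And.intro ha hp⟩
  have hz : (spectralSet q l θ).zeros = (spectralSetH q l θ 0).zeros := by
    simp only [spectralSet, spectralSetH, charFunH_zero_right]
  obtain ⟨h1, h2⟩ := spectralSetH_facts hl hq hθ hA lam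
  rw [← charFunH_zero_right, ← h2, SpectralSet.delta, SpectralSetH.delta, hz]
  refine ⟨h1, ?_⟩
  simp [spectralSet, spectralSetH]

/-- All product formulas and both reconstruction formulas. -/
theorem product_and_recovery_formulas (hl : 0 < l) {θ θ' : ℂ} (hθ : ‖θ‖ = 1) (hθ' : ‖θ'‖ = 1)
    (hne : θ ≠ θ') {h : ℝ} (hh : h ≠ 0) (hq : MemLp q 2 (volume.restrict (Ioo 0 l)))
    (hA : (spectralSetH q l θ h).Admissible) (hA' : (spectralSetH q l θ' h).Admissible)
    (lam : ℂ) :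
    (Multipliable (fun μ : (spectralSet q l θ).zeros => factor lam μ) ∧
      Multipliable (fun μ : (spectralSet q l θ').zeros => factor lam μ) ∧
      Multipliable (fun μ : (spectralSetH q l θ h).zeros => factor lam μ) ∧
      Multipliable (fun μ : (spectralSetH q l θ' h).zeros => factor lam μ)) ∧
    ((spectralSet q l θ).delta lam = charFun q l θ lam ∧
      (spectralSet q l θ').delta lam = charFun q l θ' lam ∧
      (spectralSetH q l θ h).delta lam = charFunH q l θ h lam ∧
      (spectralSetH q l θ' h).delta lam = charFunH q l θ' h lam) ∧
    s q l 2 lam = recoverS2 (spectralSet q l θ) (spectralSet q l θ') lam ∧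
    s q l 0 lam = recoverS0 (spectralSet q l θ) (spectralSet q l θ')
      (spectralSetH q l θ h) (spectralSetH q l θ' h) lam := by
  -- Square integrability enters only here: on a bounded interval it implies integrability.
  have hq1 : IntervalIntegrable q volume 0 l := by
    rw [intervalIntegrable_iff_integrableOn_Ioo_of_le hl.le]
    exact hq.integrable (by norm_num)
  obtain ⟨m1, d1⟩ := spectralSet_facts hl hq1 hθ hA.1 hA.2.1 lam
  obtain ⟨m2, d2⟩ := spectralSet_facts hl hq1 hθ' hA'.1 hA'.2.1 lam
  obtain ⟨m3, d3⟩ := spectralSetH_facts hl hq1 hθ hA lam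
  obtain ⟨m4, d4⟩ := spectralSetH_facts hl hq1 hθ' hA' lam
  have hsub : θ - θ' ≠ 0 := sub_ne_zero.2 hne
  have hhc : (h : ℂ) ≠ 0 := ofReal_ne_zero.2 hh
  -- Hence the first formula reads `s₂ = (Δ_θ' - Δ_θ) / (θ - θ')`.
  have hpi : ∀ A : SpectralSet, A.prodFun lam * (A.θ + phase A.a) = -A.delta lam := fun A => by
    rw [SpectralSet.prodFun, SpectralSet.delta]
    ring
  refine ⟨⟨m1, m2, m3, m4⟩, ⟨d1, d2, d3, d4⟩, ?_, ?_⟩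
  · rw [recoverS2, hpi, hpi, d1, d2]
    simp only [spectralSet, charFun]
    field_simp
    ring
  · rw [recoverS0, d1, d2, d3, d4]
    simp only [spectralSet, spectralSetH, charFun, charFunH, Matrix.det_fin_three,
      Matrix.of_apply, Matrix.cons_val]
    have := I_ne_zero
    field_simp
    ring

end Recover

end ThirdOrder

end

open ThirdOrder in
theorem lemma4p1 (l : ℝ) (hl : 0 < l) (θ θ' : ℂ) (hθ : ‖θ‖ = 1) (hθ' : ‖θ'‖ = 1)
    (hne : θ ≠ θ') (h : ℝ) (hh : h ≠ 0) :
    (∀ q : ℝ → ℝ, MemLp q 2 (volume.restrict (Ioo 0 l)) →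
      (spectralSetH q l θ h).Admissible → (spectralSetH q l θ' h).Admissible →
      ∀ lam : ℂ,
        (Multipliable (fun μ : (spectralSet q l θ).zeros => factor lam μ) ∧
          Multipliable (fun μ : (spectralSet q l θ').zeros => factor lam μ) ∧
          Multipliable (fun μ : (spectralSetH q l θ h).zeros => factor lam μ) ∧
          Multipliable (fun μ : (spectralSetH q l θ' h).zeros => factor lam μ)) ∧
        ((spectralSet q l θ).delta lam = charFun q l θ lam ∧
          (spectralSet q l θ').delta lam = charFun q l θ' lam ∧
          (spectralSetH q l θ h).delta lam = charFunH q l θ h lam ∧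
          (spectralSetH q l θ' h).delta lam = charFunH q l θ' h lam) ∧
        s q l 2 lam = recoverS2 (spectralSet q l θ) (spectralSet q l θ') lam ∧
        s q l 0 lam = recoverS0 (spectralSet q l θ) (spectralSet q l θ')
          (spectralSetH q l θ h) (spectralSetH q l θ' h) lam) ∧
    (∀ q r : ℝ → ℝ, MemLp q 2 (volume.restrict (Ioo 0 l)) →
      MemLp r 2 (volume.restrict (Ioo 0 l)) →
      (spectralSetH q l θ h).Admissible → (spectralSetH q l θ' h).Admissible →
      spectralSet q l θ = spectralSet r l θ → spectralSet q l θ' = spectralSet r l θ' →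
      spectralSetH q l θ h = spectralSetH r l θ h →
      spectralSetH q l θ' h = spectralSetH r l θ' h →
      ∀ lam : ℂ, s q l 2 lam = s r l 2 lam ∧ s q l 0 lam = s r l 0 lam) := by
  refine ⟨fun q hq hA hA' lam => product_and_recovery_formulas hl hθ hθ' hne hh hq hA hA' lam, ?_⟩
  intro q r hq hr hA hA' e1 e2 e3 e4 lam
  have h1 := (product_and_recovery_formulas hl hθ hθ' hne hh hq hA hA' lam).2.2
  -- Admissibility involves only the data, so it passes to the second potential through equality of
  -- the spectral sets.
  have h2 := (product_and_recovery_formulas hl hθ hθ' hne hh hr (e3 ▸ hA) (e4 ▸ hA') lam).2.2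
  rw [h1.1, h1.2, h2.1, h2.2, e1, e2, e3, e4]
  exact ⟨rfl, rfl⟩
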